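/- Let $m\ge 1$. Let $S_m$ be the symmetric group with simple transpositions $s_i=(i,i+1)$, $1\le i\le m-1$, write $x^y=y^{-1}xy$, and let $$y(m)=\langle a,S_m\mid [s_1,s_1^{a^k}]=1\ (k\in\mathbb Z),\ a^{s_i}=a^{-1}\ (2\le i\le m-1)\rangle$$ (relations involving an $s_i$ that does not exist are omitted). Let $\tilde y(m)=y(m)\rtimes\langle\tau\rangle$, where $\tau$ has order two, inverts $a$ and centralises $S_m$, and put $\tilde s_i=\tau s_i$. Let $R=\mathbb F_2[s,s^{-1}]$ be the ring of Laurent polynomials, $t=s^2$, and let $V$ be the free $R$-module with basis $u,v_1,\dots,v_m$, with the quadratic form $q$ given by $q(u)=1$, $q(v_i)=t^{-1}$ and with associated bilinear form satisfying $(u,v_i)=(v_i,v_j)=1$ for all $i$ and all $j\ne i$. Let $SO(V,q)$ be the group of $R$-linear automorphisms of $V$ that preserve $q$ and have determinant $1$, acting on the right (products are performed from left to right). For $w\in V$ with $q(w)\in R^\times$ let $r_w\in SO(V,q)$ be the transvection $x\mapsto x+\frac{(x,w)}{q(w)}w$. Let $Cl=Cl(V,q)$ be the Clifford algebra, $\alpha$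 its automorphism extending $-1_V$, $\bar x=\alpha(x^{tr})$ Clifford conjugation, where $tr$ reverses products of vectors, $C(V,q)=\{c\in Cl^\times: c^{-1}w\alpha(c)\in V\ \forall w\in V\}$ the Clifford group, $Pin(V,q)=\{c\in C(V,q): c\bar c=1\}$, and let $\pi:C(V,q)\to SO(V,q)$ be the homomorphism sending $c$ to $w\mapsto c^{-1}w\alpha(c)$. Let $\phi:\tilde y(m)\to SO(V,q)$ be the homomorphism with $\tau\mapsto r_u$, $a\mapsto r_ur_{v_1}$, $\tilde s_i\mapsto r_{v_i+v_{i+1}}$, and let $\psi:\tilde y(m)\to Pin(V,q)$ be the homomorphism with $\tau\mapsto u$, $a\mapsto s\,uv_1$, $\tilde s_i\mapsto v_i+v_{i+1}$. Then $\phi=\pi\circ\psi$, and the restriction of $\pi$ to $\psi(\tilde y(m))$ is injective. Hence $\psi$ is a trivial lifting of $\phi$: the map $\pi$ restricts to an isomorphism $\psi(\tilde y(m))\to\phi(\tilde y(m))$, and $\ker\phi=\ker\psi$. -/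

import Mathlib

namespace YGroup

open Equiv
open scoped commutatorElement

/-! ### The group `y(m)` -/

/-- A homomorphism out of the symmetric group, from images of the transpositions that satisfy the
evident relations. -/
theorem exists_permHom {G : Type*} [Group G] : ∀ (n : ℕ) (W : Fin n → Fin n → G)
    (_ : ∀ x, W x x = 1) (_ : ∀ x y, W x y = W y x) (_ : ∀ x y, W x y * W x y = 1)
    (_ : ∀ x y z t, W x y * W z t = W (swap x y z) (swap x y t) * W x y),
    ∃ f : Perm (Fin n) →* G, ∀ x y, f (swap x y) = W x y
  | 0, W, _, _, _, _ => ⟨1, fun x => x.elim0⟩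
  | n + 1, W, h1, hs, h2, hc => by
    obtain ⟨f, hf⟩ := exists_permHom n (fun x y => W x.succ y.succ) (fun x => h1 _)
      (fun x y => hs _ _) (fun x y => h2 _ _) (fun x y z t => by
        rw [hc]
        simp only [← (Fin.succ_injective n).swap_apply])
    let D := (Equiv.Perm.decomposeFin (n := n)).symm
    let F : Perm (Fin (n + 1)) → G := fun σ => W 0 (D.symm σ).1 * f (D.symm σ).2
    have hF : ∀ p e, F (D (p, e)) = W 0 p * f e := fun p e => by simp [F]
    have k1 : ∀ x y p e, swap x.succ y.succ * D (p, e) =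
        D (swap x.succ y.succ p, swap x y * e) := by
      intro x y p e
      ext z
      refine congrArg Fin.val ?_
      refine Fin.cases ?_ (fun z => ?_) z
      · simp [D]
      · have := Equiv.swap_apply_apply (swap x.succ y.succ) 0 p
        rw [swap_apply_of_ne_of_ne (Fin.succ_ne_zero _).symm (Fin.succ_ne_zero _).symm] at this
        simp [D, this, ← (Fin.succ_injective n).swap_apply]
    have k2 : ∀ y e, swap 0 (Fin.succ y) * D (0, e) = D (y.succ, e) := by
      intro y e
      ext z
      refine congrArg Fin.val ?_
      refine Fin.cases ?_ (fun z => ?_) z <;> simp [D]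
    have k3 : ∀ y e, swap 0 (Fin.succ y) * D (y.succ, e) = D (0, e) := by
      intro y e
      rw [← k2, ← mul_assoc, swap_mul_self, one_mul]
    have k4 : ∀ y i e, y ≠ i → swap 0 (Fin.succ y) * D (i.succ, e) =
        D (i.succ, swap i y * e) := by
      intro y i e hyi
      rw [← k2, ← k2, show D (0, swap i y * e) = swap i.succ y.succ * D (0, e) by
        rw [k1, swap_apply_of_ne_of_ne (Fin.succ_ne_zero _).symm (Fin.succ_ne_zero _).symm],
        ← mul_assoc, ← mul_assoc]
      congr 1
      have := Equiv.swap_apply_apply (swap 0 i.succ) i.succ y.succ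
      rw [swap_apply_right, swap_apply_of_ne_of_ne (Fin.succ_ne_zero _)
        (fun h => hyi (Fin.succ_injective n h))] at this
      rw [this]; simp [mul_assoc]
    have key0 : ∀ y p e, F (swap 0 (Fin.succ y) * D (p, e)) = W 0 y.succ * F (D (p, e)) := by
      intro y p e
      refine Fin.cases ?_ (fun i => ?_) p
      · rw [k2, hF, hF, h1, one_mul]
      · by_cases hyi : y = i
        · subst hyi
          rw [k3, hF, hF, h1, one_mul, ← mul_assoc, h2, one_mul]
        · rw [k4 _ _ _ hyi, hF, hF, map_mul, hf, ← mul_assoc, ← mul_assoc]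
          congr 1
          rw [hc 0 i.succ, swap_apply_right, swap_apply_of_ne_of_ne (Fin.succ_ne_zero _)
            (fun h => hyi (Fin.succ_injective n h))]
    have key : ∀ x y σ, F (swap x y * σ) = W x y * F σ := by
      intro x y σ
      obtain ⟨⟨p, e⟩, rfl⟩ := D.surjective σ
      refine Fin.cases ?_ (fun x => ?_) x
      · refine Fin.cases ?_ (fun y => ?_) y
        · rw [swap_self, h1, one_mul]; rfl
        · exact key0 y p e
      · refine Fin.cases ?_ (fun y => ?_) y
        · rw [swap_comm, hs]; exact key0 x p e
        · rw [k1, hF, hF, map_mul, hf, ← mul_assoc, ← mul_assoc, hc x.succ y.succ 0 p,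
            swap_apply_of_ne_of_ne (Fin.succ_ne_zero _).symm (Fin.succ_ne_zero _).symm]
    have F1 : F 1 = 1 := by
      have : (1 : Perm (Fin (n + 1))) = D (0, 1) := by
        simp only [D, Equiv.Perm.decomposeFin_symm_of_one, swap_self]; rfl
      rw [this, hF, h1, map_one, one_mul]
    refine ⟨MonoidHom.mk' F fun σ τ => ?_, fun x y => ?_⟩
    · induction σ using Equiv.Perm.swap_induction_on with
      | one => rw [one_mul, F1, one_mul]
      | swap_mul σ x y _ ih => rw [mul_assoc, key, key, ih, ← mul_assoc (W x y)]
    · have := key x y 1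
      rw [mul_one, F1, mul_one] at this
      exact this

/-- The simple transposition `(i, i+1)` (numbered from `0`) of the symmetric group. -/
def adj (m i : ℕ) (h : i + 1 < m) : Perm (Fin m) := swap ⟨i, by omega⟩ ⟨i + 1, h⟩

/-- The free product of an infinite cyclic group `⟨a⟩` and the symmetric group `S_m`. -/
abbrev Pre (m : ℕ) : Type := Monoid.Coprod (Multiplicative ℤ) (Perm (Fin m))

def preA (m : ℕ) : Pre m := Monoid.Coprod.inl (Multiplicative.ofAdd 1)

def preS (m i : ℕ) (h : i + 1 < m) : Pre m := Monoid.Coprod.inr (adj m i h)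

/-- The relators `[s₁, s₁ ^ (a ^ k)]` for `k ∈ ℤ` and `a ^ s_i = a⁻¹` for `2 ≤ i ≤ m - 1`, where
`x ^ y = y⁻¹ x y`. As indices start from `0` here, `s₁` is `preS m 0 _`. -/
def rels (m : ℕ) : Set (Pre m) :=
  {x | ∃ (h : 0 + 1 < m) (k : ℤ),
      x = ⁅preS m 0 h, (preA m ^ k)⁻¹ * preS m 0 h * preA m ^ k⁆} ∪
  {x | ∃ (i : ℕ) (h : i + 1 < m), 1 ≤ i ∧ x = (preS m i h)⁻¹ * preA m * preS m i h * preA m}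

/-- The group `y(m) = ⟨a, S_m | [s₁, s₁ ^ (a ^ k)] = 1, a ^ s_i = a⁻¹ (2 ≤ i ≤ m - 1)⟩`. -/
abbrev Y (m : ℕ) : Type := Pre m ⧸ Subgroup.normalClosure (rels m)

namespace Y

def a (m : ℕ) : Y m := QuotientGroup.mk (preA m)

def perm (m : ℕ) : Perm (Fin m) →* Y m :=
  (QuotientGroup.mk' (Subgroup.normalClosure (rels m))).comp Monoid.Coprod.inr

def s (m i : ℕ) (h : i + 1 < m) : Y m := perm m (adj m i h)

theorem exists_lift {G : Type*} [Group G] (m : ℕ) (A : G) (f : Perm (Fin m) →* G)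
    (hk : ∀ (h : 0 + 1 < m) (k : ℤ),
      ⁅f (adj m 0 h), (A ^ k)⁻¹ * f (adj m 0 h) * A ^ k⁆ = 1)
    (hs : ∀ (i : ℕ) (h : i + 1 < m), 1 ≤ i →
      (f (adj m i h))⁻¹ * A * f (adj m i h) * A = 1) :
    ∃ F : Y m →* G, F (a m) = A ∧ ∀ σ, F (perm m σ) = f σ := by
  let g : Pre m →* G := Monoid.Coprod.lift (zpowersHom G A) f
  have ga : g (preA m) = A := by simp [g, preA]
  have gs : ∀ i h, g (preS m i h) = f (adj m i h) := fun i h => by simp [g, preS]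
  have hle : Subgroup.normalClosure (rels m) ≤ g.ker := by
    refine Subgroup.normalClosure_le_normal ?_
    rintro x (⟨h, k, rfl⟩ | ⟨i, h, hi, rfl⟩)
    · simp only [SetLike.mem_coe, MonoidHom.mem_ker, map_commutatorElement, map_mul, map_inv,
        map_zpow, ga, gs]
      exact hk h k
    · simp only [SetLike.mem_coe, MonoidHom.mem_ker, map_mul, map_inv, ga, gs]
      exact hs i h hi
  refine ⟨QuotientGroup.lift _ g hle, ?_, fun σ => ?_⟩
  · exact ga
  · change g (Monoid.Coprod.inr σ) = f σ
    simp [g]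

theorem hom_ext {G : Type*} [Group G] {m : ℕ} {F F' : Y m →* G} (ha : F (a m) = F' (a m))
    (hp : ∀ σ, F (perm m σ) = F' (perm m σ)) : F = F' := by
  refine QuotientGroup.monoidHom_ext _ (Monoid.Coprod.hom_ext ?_ (MonoidHom.ext hp))
  exact MonoidHom.ext_mint ha

theorem comm_rel (m : ℕ) (h : 0 + 1 < m) (k : ℤ) :
    ⁅s m 0 h, (a m ^ k)⁻¹ * s m 0 h * a m ^ k⁆ = 1 :=
  (QuotientGroup.eq_one_iff _).2 (Subgroup.subset_normalClosure (Or.inl ⟨h, k, rfl⟩))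

theorem inv_rel (m i : ℕ) (h : i + 1 < m) (hi : 1 ≤ i) :
    (s m i h)⁻¹ * a m * s m i h * a m = 1 :=
  (QuotientGroup.eq_one_iff _).2 (Subgroup.subset_normalClosure (Or.inr ⟨i, h, hi, rfl⟩))

theorem exists_tau (m : ℕ) :
    ∃ F : Y m →* Y m, F (a m) = (a m)⁻¹ ∧ ∀ σ, F (perm m σ) = perm m σ := by
  refine exists_lift m (a m)⁻¹ (perm m) (fun h k => ?_) (fun i h hi => ?_)
  · have := comm_rel m h (-k)
    rwa [zpow_neg, ← inv_zpow] at this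
  · have := inv_rel m i h hi
    have h2 : (s m i h)⁻¹ * a m * s m i h = (a m)⁻¹ := eq_inv_of_mul_eq_one_left this
    have h3 := congrArg (·⁻¹) h2
    simp only [mul_inv_rev, inv_inv] at h3
    change (s m i h)⁻¹ * (a m)⁻¹ * s m i h * (a m)⁻¹ = 1
    rw [mul_assoc (s m i h)⁻¹, h3, mul_inv_cancel]

/-- The endomorphism of `y(m)` inverting `a` and fixing every element of `S_m`. -/
noncomputable def tauHom (m : ℕ) : Y m →* Y m := (exists_tau m).choose

theorem tauHom_a (m : ℕ) : tauHom m (a m) = (a m)⁻¹ := (exists_tau m).choose_spec.1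

theorem tauHom_perm (m : ℕ) (σ : Perm (Fin m)) : tauHom m (perm m σ) = perm m σ :=
  (exists_tau m).choose_spec.2 σ

theorem tauHom_comp (m : ℕ) : (tauHom m).comp (tauHom m) = MonoidHom.id (Y m) :=
  hom_ext (by simp [tauHom_a]) (fun σ => by simp [tauHom_perm])

/-- The automorphism of `y(m)` inverting `a` and fixing every element of `S_m`. -/
noncomputable def tauAut (m : ℕ) : MulAut (Y m) :=
  MonoidHom.toMulEquiv (tauHom m) (tauHom m) (tauHom_comp m) (tauHom_comp m)

theorem tauAut_sq (m : ℕ) : tauAut m ^ 2 = 1 := by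
  ext x
  exact DFunLike.congr_fun (tauHom_comp m) x

/-- The action of the group `C₂` of order two on `y(m)` in which the generator acts as `tauAut`. -/
noncomputable def tauAct (m : ℕ) : Multiplicative (ZMod 2) →* MulAut (Y m) :=
  AddMonoidHom.toMultiplicativeLeft (ZMod.lift 2
    ⟨zmultiplesHom (Additive (MulAut (Y m))) (Additive.ofMul (tauAut m)), by
      rw [zmultiplesHom_apply]
      exact_mod_cast congrArg Additive.ofMul (tauAut_sq m)⟩)

theorem tauAct_gen (m : ℕ) : tauAct m (Multiplicative.ofAdd 1) = tauAut m := by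
  simp [tauAct]
  rfl

end Y

/-! ### The quadratic module -/

/-- The ring `R = 𝔽₂[s, s⁻¹]`, where `s` is `LaurentPolynomial.T 1` and `t = s ^ 2`. -/
abbrev R : Type := LaurentPolynomial (ZMod 2)

/-- The free `R`-module of rank `m + 1`; the first basis vector is `u`, the others are the `v i`. -/
abbrev V (m : ℕ) : Type := Fin (m + 1) → R

noncomputable def u (m : ℕ) : V m := Pi.single 0 1

noncomputable def v (m : ℕ) (i : Fin m) : V m := Pi.single i.succ 1

/-- The upper triangular matrix with entry `1` above the diagonal and with diagonal
`1, t⁻¹, …, t⁻¹`, where `t⁻¹ = s ^ (-2)`. -/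
noncomputable def qMatrix (m : ℕ) : Matrix (Fin (m + 1)) (Fin (m + 1)) R :=
  Matrix.of fun i j =>
    if i = j then (if i = 0 then 1 else LaurentPolynomial.T (-2)) else if i < j then 1 else 0

noncomputable def qBilin (m : ℕ) : LinearMap.BilinForm R (V m) := Matrix.toBilin' (qMatrix m)

/-- The quadratic form with `q u = 1`, `q (v i) = t⁻¹` and with `(u, v i) = (v i, v j) = 1` for
`i ≠ j`; see `q_u`, `q_v`, `polar_u_v`, `polar_v_v`. The bilinear form `(x, y)` is
`QuadraticMap.polar (q m) x y = q (x + y) - q x - q y`. -/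
noncomputable def q (m : ℕ) : QuadraticForm R (V m) := (qBilin m).toQuadraticMap

theorem two_R : (2 : R) = 0 := by
  have : (2 : R) = LaurentPolynomial.C (2 : ZMod 2) :=
    (map_ofNat LaurentPolynomial.C 2).symm
  rw [this, show (2 : ZMod 2) = 0 from rfl, map_zero]

theorem add_self_R (x : R) : x + x = 0 := by rw [← two_mul, two_R, zero_mul]

theorem neg_eq_R (x : R) : -x = x := neg_eq_of_add_eq_zero_left (add_self_R x)

theorem qBilin_single (m : ℕ) (i j : Fin (m + 1)) :
    qBilin m (Pi.single i 1) (Pi.single j 1) = qMatrix m i j := by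
  simp [qBilin]

theorem q_single (m : ℕ) (i : Fin (m + 1)) : q m (Pi.single i 1) = qMatrix m i i := by
  rw [q, LinearMap.BilinMap.toQuadraticMap_apply, qBilin_single]

theorem polar_eq (m : ℕ) (x y : V m) :
    QuadraticMap.polar (q m) x y = (∑ i, x i) * (∑ i, y i) + ∑ i, x i * y i := by
  have key : QuadraticMap.polar (q m) x y = ∑ i, ∑ j, x i * y j * (if i = j then 0 else 1) := by
    rw [q, LinearMap.BilinMap.polar_toQuadraticMap, qBilin, Matrix.toBilin'_apply,
      Matrix.toBilin'_apply, Finset.sum_comm (f := fun i j => y i * qMatrix m i j * x j),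
      ← Finset.sum_add_distrib]
    refine Finset.sum_congr rfl fun i _ => ?_
    rw [← Finset.sum_add_distrib]
    refine Finset.sum_congr rfl fun j _ => ?_
    by_cases h : i = j
    · subst h
      simp only [if_true, mul_zero]
      rw [show y i * qMatrix m i i * x i = x i * qMatrix m i i * y i by ring, add_self_R]
    · simp only [qMatrix, Matrix.of_apply, h, Ne.symm h, if_false]
      rcases lt_or_gt_of_ne h with h' | h'
      · simp [h', h'.not_gt]
      · simp [h', h'.not_gt, mul_comm]
  have k2 : ∀ i j : Fin (m + 1), x i * y j * (if i = j then (0 : R) else 1) =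
      x i * y j + (if i = j then x i * y j else 0) := by
    intro i j
    split_ifs with h
    · rw [mul_zero, add_self_R]
    · rw [mul_one, add_zero]
  rw [key, Finset.sum_mul_sum]
  simp only [k2, Finset.sum_add_distrib, Finset.sum_ite_eq, Finset.mem_univ, if_true]

theorem q_u (m : ℕ) : q m (u m) = 1 := by simp [u, q_single, qMatrix]

theorem q_v (m : ℕ) (i : Fin m) : q m (v m i) = LaurentPolynomial.T (-2) := by
  simp [v, q_single, qMatrix]

theorem polar_single (m : ℕ) (i j : Fin (m + 1)) (h : i ≠ j) :
    QuadraticMap.polar (q m) (Pi.single i 1) (Pi.single j 1) = 1 := by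
  rw [polar_eq]
  simp [Pi.single_apply, h.symm]

theorem polar_u_v (m : ℕ) (i : Fin m) : QuadraticMap.polar (q m) (u m) (v m i) = 1 :=
  polar_single m _ _ (Fin.succ_ne_zero i).symm

theorem polar_v_v (m : ℕ) (i j : Fin m) (h : i ≠ j) :
    QuadraticMap.polar (q m) (v m i) (v m j) = 1 :=
  polar_single m _ _ fun h' => h (Fin.succ_injective m h')

theorem q_v_add_v (m : ℕ) (i j : Fin m) (h : i ≠ j) : q m (v m i + v m j) = 1 := by
  rw [QuadraticMap.map_add (q m), polar_v_v m i j h, q_v, q_v, add_self_R, zero_add]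

/-! ### Orthogonal groups -/

/-- The sum of all basis vectors; it spans the radical of the bilinear form when `m` is even. -/
noncomputable def radVec (m : ℕ) : V m := fun _ => 1

theorem polar_radVec (m : ℕ) (hm : Even m) (x : V m) :
    QuadraticMap.polar (q m) (radVec m) x = 0 := by
  rw [polar_eq]
  have : ((m : R) + 1) = 1 := by
    obtain ⟨k, rfl⟩ := hm
    push_cast
    rw [add_self_R, zero_add]
  simp [radVec, this, add_self_R]

theorem gram_congr {K n : Type*} [CommRing K] [Fintype n] [DecidableEq n] (A : Matrix n n K)
    (hG : ∀ i j, (∑ k, A k i) * (∑ k, A k j) + ∑ k, A k i * A k j = (1 : Matrix n n K) i j + 1)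
    (l : n → K) :
    A.transpose * (Matrix.of fun i j => (1 : Matrix n n K) i j + 1 + l i * l j) * A =
      Matrix.of fun i j => (1 : Matrix n n K) i j + 1 +
        (∑ k, l k * A k i) * (∑ k, l k * A k j) := by
  have h1 : ∀ l : n → K, (Matrix.of fun i j => (1 : Matrix n n K) i j + 1 + l i * l j) =
      1 + Matrix.vecMulVec 1 1 + Matrix.vecMulVec l l := by
    intro l
    ext i j
    simp [Matrix.vecMulVec_apply]
  rw [h1, mul_add, mul_add, add_mul, add_mul, Matrix.mul_one, Matrix.mul_vecMulVec,
    Matrix.mul_vecMulVec, Matrix.vecMulVec_mul, Matrix.vecMulVec_mul]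
  ext i j
  simp only [Matrix.add_apply, Matrix.vecMulVec_apply, Matrix.of_apply, ← hG, Matrix.mul_apply,
    Matrix.transpose_apply, Matrix.mulVec, Matrix.vecMul, dotProduct, Pi.one_apply, mul_one,
    one_mul, mul_comm (A _ i) (l _)]
  ring

theorem det_gram (m : ℕ) (l : V m) :
    (Matrix.of fun i j : Fin (m + 1) => (1 : Matrix _ _ R) i j + 1 + l i * l j).det =
      (m : R) * (1 + ∑ i, l i * l i) + (∑ i, l i) ^ 2 := by
  let P : Matrix (Fin (m + 1)) (Fin 2) R := Matrix.of fun i => ![1, l i]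
  have h : (Matrix.of fun i j : Fin (m + 1) => (1 : Matrix _ _ R) i j + 1 + l i * l j) =
      1 + P * P.transpose := by
    ext1 i j
    simp [P, Matrix.mul_apply, Fin.sum_univ_two, add_assoc]
  rw [h, Matrix.det_one_add_mul_comm, Matrix.det_fin_two]
  simp [P, Matrix.mul_apply]
  linear_combination ((1 + ∑ i, l i * l i) - (∑ i, l i) ^ 2) * two_R

theorem det_eq_one (m : ℕ) (L : V m →ₗ[R] V m) (hL : ∀ x, q m (L x) = q m x)
    (hr : Even m → L (radVec m) = radVec m) : LinearMap.det L = 1 := by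
  set A := LinearMap.toMatrix' L with hA
  rw [← LinearMap.det_toMatrix', ← hA]
  have hp : ∀ x y, QuadraticMap.polar (q m) (L x) (L y) = QuadraticMap.polar (q m) x y := by
    intro x y
    simp only [QuadraticMap.polar, ← map_add, hL]
  have hAe : ∀ i j, A i j = L (Pi.single j 1) i := fun i j => by
    rw [hA, LinearMap.toMatrix'_apply]
  have hG : ∀ i j, (∑ k, A k i) * (∑ k, A k j) + ∑ k, A k i * A k j =
      (1 : Matrix _ _ R) i j + 1 := by
    intro i j
    have := hp (Pi.single i 1) (Pi.single j 1)
    rw [polar_eq, polar_eq] at this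
    simp only [hAe, this]
    simp [Matrix.one_apply, Pi.single_apply, add_comm, eq_comm]
  have hdet : ∀ l : V m, A.det ^ 2 * ((m : R) * (1 + ∑ i, l i * l i) + (∑ i, l i) ^ 2) =
      (m : R) * (1 + ∑ i, (∑ k, l k * A k i) * (∑ k, l k * A k i)) +
        (∑ i, ∑ k, l k * A k i) ^ 2 := by
    intro l
    rw [← det_gram m l, ← det_gram m (fun i => ∑ k, l k * A k i), pow_two]
    nth_rewrite 1 [← Matrix.det_transpose A]
    rw [mul_right_comm, ← Matrix.det_mul, ← Matrix.det_mul]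
    rw [gram_congr A hG l]
  have hsq : A.det ^ 2 = 1 := by
    rcases Nat.even_or_odd m with he | ho
    · have hm : (m : R) = 0 := by
        obtain ⟨k, rfl⟩ := he
        push_cast
        exact add_self_R _
      have h0 : ∀ i, ∑ k, A i k = 1 := by
        intro i
        have h1 := congrFun (hr he) i
        rw [← LinearMap.toMatrix'_mulVec L, ← hA] at h1
        simpa [Matrix.mulVec, dotProduct, radVec] using h1
      have := hdet (Pi.single 0 1)
      simpa [hm, Pi.single_apply, h0] using this
    · have hm : (m : R) = 1 := by
        obtain ⟨k, rfl⟩ := ho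
        push_cast
        rw [two_R, zero_mul, zero_add]
      have := hdet 0
      simpa [hm] using this
  have : (A.det + 1) ^ 2 = 0 := by linear_combination hsq + (A.det + 1) * two_R
  have := pow_eq_zero_iff (two_ne_zero) |>.1 this
  linear_combination this - two_R

/-- The general orthogonal group, as a group of linear automorphisms (under composition). -/
def GO (m : ℕ) : Subgroup (V m ≃ₗ[R] V m) where
  carrier := {g | ∀ x, q m (g x) = q m x}
  mul_mem' := fun {g h} hg hh x => (hg (h x)).trans (hh x)
  one_mem' := fun _ => rfl
  inv_mem' := fun {g} hg x => by
    have := hg (g⁻¹ x)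
    rw [← this]
    exact congrArg (q m) (g.apply_symm_apply x)

/-- The special orthogonal group: the isometries of determinant one. -/
noncomputable def SO (m : ℕ) : Subgroup (V m ≃ₗ[R] V m) := GO m ⊓ LinearEquiv.det.ker

noncomputable def mkSO (m : ℕ) (L : V m →ₗ[R] V m) (hL : ∀ x, q m (L x) = q m x)
    (hr : Even m → L (radVec m) = radVec m) : SO m :=
  ⟨LinearEquiv.ofIsUnitDet (f := L) (v := Pi.basisFun R _) (v' := Pi.basisFun R _) (by
    rw [LinearMap.det_toMatrix, det_eq_one m L hL hr]; exact isUnit_one),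
    hL, by
      refine MonoidHom.mem_ker.2 ?_
      ext1
      rw [LinearEquiv.coe_det]
      exact det_eq_one m L hL hr⟩

@[simp]
theorem mkSO_apply (m : ℕ) (L : V m →ₗ[R] V m) (hL : ∀ x, q m (L x) = q m x)
    (hr : Even m → L (radVec m) = radVec m) (x : V m) : (mkSO m L hL hr).1 x = L x := rfl

theorem SO_ext {m : ℕ} {g h : SO m} (H : ∀ x, g.1 x = h.1 x) : g = h :=
  Subtype.ext (LinearEquiv.ext H)

/-- The linear map `x ↦ x + ((x, w) / q w) w`, for `q w` invertible. -/
noncomputable def transvLin (m : ℕ) (w : V m) (hw : IsUnit (q m w)) : V m →ₗ[R] V m :=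
  LinearMap.id + (((↑hw.unit⁻¹ : R) • (q m).polarBilin w)).smulRight w

theorem transvLin_apply (m : ℕ) (w : V m) (hw : IsUnit (q m w)) (x : V m) :
    transvLin m w hw x = x + ((↑hw.unit⁻¹ : R) * QuadraticMap.polar (q m) x w) • w := by
  rw [QuadraticMap.polar_comm]
  simp [transvLin]

/-- The orthogonal transvection `r_w : x ↦ x + ((x, w) / q w) w`. -/
noncomputable def transv (m : ℕ) (w : V m) (hw : IsUnit (q m w)) : SO m :=
  mkSO m (transvLin m w hw)
    (fun x => by
      have h : (↑hw.unit⁻¹ : R) * q m w = 1 := hw.val_inv_mul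
      rw [transvLin_apply, QuadraticMap.map_add (q m), QuadraticMap.map_smul,
        QuadraticMap.polar_smul_right, smul_eq_mul, smul_eq_mul]
      set c := (↑hw.unit⁻¹ : R)
      set b := QuadraticMap.polar (q m) x w
      linear_combination c * b * b * h + c * b * b * two_R)
    (fun hm => by rw [transvLin_apply, polar_radVec m hm, mul_zero, zero_smul, add_zero])

theorem transv_apply (m : ℕ) (w : V m) (hw : IsUnit (q m w)) (x : V m) :
    (transv m w hw).1 x = x + ((↑hw.unit⁻¹ : R) * QuadraticMap.polar (q m) x w) • w :=
  transvLin_apply m w hw x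

/-! ### The Clifford algebra, the Clifford group and the pin group -/

abbrev Cl (m : ℕ) : Type := CliffordAlgebra (q m)

noncomputable abbrev ι (m : ℕ) : V m →ₗ[R] Cl m := CliffordAlgebra.ι (q m)

theorem ι_injective (m : ℕ) : Function.Injective (ι m) := by
  have h : (qBilin m).toQuadraticMap = q m - 0 := by rw [sub_zero, q]
  have h2 := (CliffordAlgebra.changeFormEquiv h).symm
  intro x y hxy
  have h3 := congrArg (CliffordAlgebra.changeForm (CliffordAlgebra.changeForm.neg_proof h)) hxy
  rw [CliffordAlgebra.changeForm_ι, CliffordAlgebra.changeForm_ι] at h3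
  exact ExteriorAlgebra.ι_leftInverse.injective h3

theorem algebraMap_injective (m : ℕ) : Function.Injective (algebraMap R (Cl m)) := by
  have h : (qBilin m).toQuadraticMap = q m - 0 := by rw [sub_zero, q]
  intro x y hxy
  have h3 := congrArg (CliffordAlgebra.changeForm (CliffordAlgebra.changeForm.neg_proof h)) hxy
  rw [CliffordAlgebra.changeForm_algebraMap, CliffordAlgebra.changeForm_algebraMap] at h3
  exact (ExteriorAlgebra.algebraMap_leftInverse (V m)).injective h3

theorem two_Cl (m : ℕ) : (2 : Cl m) = 0 := by
  rw [← map_ofNat (algebraMap R (Cl m)) 2, two_R, map_zero]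

theorem add_self_Cl {m : ℕ} (x : Cl m) : x + x = 0 := by rw [← two_mul, two_Cl, zero_mul]

theorem neg_eq_Cl {m : ℕ} (x : Cl m) : -x = x := neg_eq_of_add_eq_zero_left (add_self_Cl x)

theorem involute_eq {m : ℕ} (x : Cl m) : CliffordAlgebra.involute x = x := by
  have : (CliffordAlgebra.involute : Cl m →ₐ[R] Cl m) = AlgHom.id R _ := by
    refine CliffordAlgebra.hom_ext (LinearMap.ext fun w => ?_)
    exact (CliffordAlgebra.involute_ι w).trans (neg_eq_Cl _)
  rw [this]; rfl

/-- The map `x ↦ c⁻¹ x α(c)` of the Clifford algebra. -/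
noncomputable def twist {m : ℕ} (c : (Cl m)ˣ) : Cl m →ₗ[R] Cl m :=
  LinearMap.mulRight R (CliffordAlgebra.involute (c : Cl m)) ∘ₗ
    LinearMap.mulLeft R ((c⁻¹ : (Cl m)ˣ) : Cl m)

theorem twist_apply {m : ℕ} (c : (Cl m)ˣ) (x : Cl m) :
    twist c x = ((c⁻¹ : (Cl m)ˣ) : Cl m) * x * CliffordAlgebra.involute (c : Cl m) := rfl

theorem twist_eq {m : ℕ} (c : (Cl m)ˣ) (x : Cl m) :
    twist c x = ((c⁻¹ : (Cl m)ˣ) : Cl m) * x * (c : Cl m) := by rw [twist_apply, involute_eq]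

/-- The condition `c⁻¹ w α(c) ∈ V` for all `w ∈ V`. -/
def IsClifford {m : ℕ} (c : (Cl m)ˣ) : Prop := ∀ w, twist c (ι m w) ∈ LinearMap.range (ι m)

/-- The map `w ↦ c⁻¹ w α(c)` as a linear map from `V` to `V`. -/
noncomputable def piLin {m : ℕ} (c : (Cl m)ˣ) (hc : IsClifford c) : V m →ₗ[R] V m :=
  (LinearEquiv.ofInjective (ι m) (ι_injective m)).symm.toLinearMap ∘ₗ
    (twist c ∘ₗ ι m).codRestrict (LinearMap.range (ι m)) hc

theorem ι_piLin {m : ℕ} (c : (Cl m)ˣ) (hc : IsClifford c) (w : V m) :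
    ι m (piLin c hc w) = twist c (ι m w) := by
  have := LinearEquiv.apply_symm_apply (LinearEquiv.ofInjective (ι m) (ι_injective m))
    ((twist c ∘ₗ ι m).codRestrict (LinearMap.range (ι m)) hc w)
  exact congrArg Subtype.val this

theorem q_piLin {m : ℕ} (c : (Cl m)ˣ) (hc : IsClifford c) (w : V m) :
    q m (piLin c hc w) = q m w := by
  apply algebraMap_injective m
  rw [← CliffordAlgebra.ι_sq_scalar, ι_piLin, twist_eq, mul_assoc, mul_assoc, mul_assoc,
    Units.mul_inv_cancel_left, ← mul_assoc (ι m w), CliffordAlgebra.ι_sq_scalar,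
    Algebra.commutes, Units.inv_mul_cancel_left]

theorem radVec_comm (m : ℕ) (hm : Even m) (x : Cl m) :
    ι m (radVec m) * x = x * ι m (radVec m) := by
  induction x using CliffordAlgebra.induction with
  | algebraMap r => exact (Algebra.commutes r _).symm
  | ι w =>
    have := CliffordAlgebra.ι_mul_ι_add_swap (Q := q m) (radVec m) w
    rw [polar_radVec m hm, map_zero] at this
    rw [eq_neg_of_add_eq_zero_left this, neg_eq_Cl]
  | mul a b ha hb => rw [← mul_assoc, ha, mul_assoc, hb, mul_assoc]
  | add a b ha hb => rw [mul_add, add_mul, ha, hb]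

theorem piLin_radVec {m : ℕ} (c : (Cl m)ˣ) (hc : IsClifford c) (hm : Even m) :
    piLin c hc (radVec m) = radVec m := by
  apply ι_injective m
  rw [ι_piLin, twist_eq, mul_assoc, radVec_comm m hm, Units.inv_mul_cancel_left]

/-- The map `w ↦ c⁻¹ w α(c)` as an element of the special orthogonal group. -/
noncomputable def piSO {m : ℕ} (c : (Cl m)ˣ) (hc : IsClifford c) : SO m :=
  mkSO m (piLin c hc) (q_piLin c hc) (piLin_radVec c hc)

theorem ι_piSO {m : ℕ} (c : (Cl m)ˣ) (hc : IsClifford c) (w : V m) :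
    ι m ((piSO c hc).1 w) = twist c (ι m w) := ι_piLin c hc w

/-- The Clifford group: the units `c` of `Cl(V, q)` with `c⁻¹ w α(c) ∈ V` for all `w ∈ V`. -/
def CliffordGroup (m : ℕ) : Subgroup (Cl m)ˣ where
  carrier := {c | IsClifford c}
  mul_mem' := fun {c d} hc hd w => by
    refine ⟨piLin d hd (piLin c hc w), ?_⟩
    rw [ι_piLin, ι_piLin]
    simp [twist_eq, mul_assoc]
  one_mem' := fun w => ⟨w, by simp [twist_eq]⟩
  inv_mem' := fun {c} hc w => by
    refine ⟨(piSO c hc).1.symm w, ?_⟩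
    have := ι_piSO c hc ((piSO c hc).1.symm w)
    rw [LinearEquiv.apply_symm_apply] at this
    rw [this]
    simp [twist_eq, mul_assoc]

/-- The natural homomorphism `π` sending `c` to the map `w ↦ c⁻¹ w α(c)`. Since `π(cd)` is `π(c)`
followed by `π(d)`, the target is the special orthogonal group acting from the right: a product in
`(SO m)ᵐᵒᵖ` is performed from left to right. -/
noncomputable def π (m : ℕ) : CliffordGroup m →* (SO m)ᵐᵒᵖ where
  toFun c := MulOpposite.op (piSO c.1 c.2)
  map_one' := MulOpposite.unop_injective <| SO_ext fun x => ι_injective m <| by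
    refine (ι_piSO _ _ x).trans ?_
    simp [twist_eq]
  map_mul' c d := MulOpposite.unop_injective <| SO_ext fun x => ι_injective m <| by
    refine (ι_piSO _ _ x).trans ?_
    refine Eq.trans ?_ (ι_piSO d.1 d.2 ((piSO c.1 c.2).1 x)).symm
    refine Eq.trans ?_ (congrArg (twist d.1) (ι_piSO c.1 c.2 x)).symm
    simp [twist_eq, mul_assoc]

theorem ι_π {m : ℕ} (c : CliffordGroup m) (w : V m) :
    ι m ((π m c).unop.1 w) = ((c.1⁻¹ : (Cl m)ˣ) : Cl m) * ι m w * (c.1 : Cl m) := by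
  rw [← twist_eq]; exact ι_piSO c.1 c.2 w

/-- Clifford conjugation `x ↦ α(xᵗʳ)`. -/
noncomputable def conj {m : ℕ} (x : Cl m) : Cl m :=
  CliffordAlgebra.involute (CliffordAlgebra.reverse x)

theorem conj_mul {m : ℕ} (x y : Cl m) : conj (x * y) = conj y * conj x := by
  simp [conj]

theorem conj_conj {m : ℕ} (x : Cl m) : conj (conj x) = x := by
  simp [conj, involute_eq]

/-- The pin group: the elements `c` of the Clifford group with `c * conj c = 1`. -/
def Pin (m : ℕ) : Subgroup (CliffordGroup m) where
  carrier := {c | (c.1 : Cl m) * conj (c.1 : Cl m) = 1}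
  mul_mem' := fun {c d} hc hd => by
    simp only [Set.mem_ofPred_eq, Subgroup.coe_mul, Units.val_mul] at *
    rw [conj_mul, mul_assoc, ← mul_assoc (d.1 : Cl m), hd, one_mul, hc]
  one_mem' := by simp [conj]
  inv_mem' := fun {c} hc => by
    simp only [Set.mem_ofPred_eq] at *
    have h : ((c⁻¹).1 : Cl m) = conj (c.1 : Cl m) := by
      rw [Subgroup.coe_inv]
      exact Units.inv_eq_of_mul_eq_one_right hc
    rw [h, conj_conj, ← h, Subgroup.coe_inv, Units.inv_mul]

theorem Pin_ext {m : ℕ} {c d : Pin m} (h : (c.1.1 : Cl m) = d.1.1) : c = d :=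
  Subtype.ext (Subtype.ext (Units.ext h))

theorem ι_sq (m : ℕ) (w : V m) (hw : q m w = 1) : ι m w * ι m w = 1 := by
  rw [CliffordAlgebra.ι_sq_scalar, hw, map_one]

/-- A vector `w` with `q w = 1`, as an element of the pin group. -/
noncomputable def pinVec (m : ℕ) (w : V m) (hw : q m w = 1) : Pin m :=
  ⟨⟨⟨ι m w, ι m w, ι_sq m w hw, ι_sq m w hw⟩, fun x => by
      refine ⟨x + QuadraticMap.polar (q m) w x • w, ?_⟩
      have h := CliffordAlgebra.ι_mul_ι_add_swap (Q := q m) w x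
      have h2 : ι m w * ι m x = algebraMap R (Cl m) (QuadraticMap.polar (q m) w x) +
          ι m x * ι m w := by rw [← h, add_assoc, add_self_Cl, add_zero]
      rw [twist_eq]
      change _ = ι m w * ι m x * ι m w
      rw [h2, add_mul, mul_assoc, ι_sq m w hw, map_add, map_smul, mul_one, add_comm,
        Algebra.smul_def]⟩, by
    change ι m w * conj (ι m w) = 1
    rw [conj, involute_eq, CliffordAlgebra.reverse_ι, ι_sq m w hw]⟩

@[simp]
theorem coe_pinVec (m : ℕ) (w : V m) (hw : q m w = 1) : ((pinVec m w hw).1.1 : Cl m) = ι m w := rfl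

@[simp]
theorem coe_pinVec_inv (m : ℕ) (w : V m) (hw : q m w = 1) :
    (((pinVec m w hw).1.1⁻¹ : (Cl m)ˣ) : Cl m) = ι m w := rfl

theorem π_pinVec (m : ℕ) (w : V m) (hw : q m w = 1) (w' : V m) (r : R) (hr : w = r • w')
    (hw' : IsUnit (q m w')) :
    π m (pinVec m w hw).1 = MulOpposite.op (transv m w' hw') := by
  refine MulOpposite.unop_injective <| SO_ext fun x => ι_injective m ?_
  have hinv : (↑hw'.unit⁻¹ : R) = r * r := by
    have h1 : (↑hw'.unit⁻¹ : R) * q m w' = 1 := hw'.val_inv_mul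
    have h2 : r * r * q m w' = 1 := by rw [← hw, hr, QuadraticMap.map_smul, smul_eq_mul]
    linear_combination r * r * h1 - (↑hw'.unit⁻¹ : R) * h2
  have e : QuadraticMap.polar (q m) w x • w =
      ((↑hw'.unit⁻¹ : R) * QuadraticMap.polar (q m) x w') • w' := by
    have h3 : QuadraticMap.polar (q m) w x = r * QuadraticMap.polar (q m) x w' := by
      rw [hr, QuadraticMap.polar_smul_left, QuadraticMap.polar_comm (q m) x w', smul_eq_mul]
    calc QuadraticMap.polar (q m) w x • w = (r * QuadraticMap.polar (q m) x w') • (r • w') := by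
          rw [h3, ← hr]
      _ = (r * r * QuadraticMap.polar (q m) x w') • w' := by
          rw [smul_smul, mul_right_comm]
      _ = _ := by rw [hinv]
  have h := CliffordAlgebra.ι_mul_ι_add_swap (Q := q m) w x
  have h2 : ι m w * ι m x = algebraMap R (Cl m) (QuadraticMap.polar (q m) w x) +
      ι m x * ι m w := by rw [← h, add_assoc, add_self_Cl, add_zero]
  rw [ι_π, MulOpposite.unop_op, transv_apply, ← e, coe_pinVec, coe_pinVec_inv, h2, add_mul,
    mul_assoc, ι_sq m w hw, mul_one, ← Algebra.smul_def, map_add, map_smul, add_comm]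

/-! ### The group `ỹ(m)` -/

/-- The semidirect product of `y(m)` with the group `⟨τ⟩` of order two, where `τ` inverts `a` and
centralises `S_m`. -/
abbrev YT (m : ℕ) : Type := Y m ⋊[Y.tauAct m] Multiplicative (ZMod 2)

namespace YT

noncomputable def τ (m : ℕ) : YT m := SemidirectProduct.inr (Multiplicative.ofAdd 1)

noncomputable def a (m : ℕ) : YT m := SemidirectProduct.inl (Y.a m)

noncomputable def s (m i : ℕ) (h : i + 1 < m) : YT m := SemidirectProduct.inl (Y.s m i h)

/-- The element `s̃_i = τ s_i` (with `i` numbered from `0`). -/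
noncomputable def sTilde (m i : ℕ) (h : i + 1 < m) : YT m := τ m * s m i h

theorem exists_lift {G : Type*} [Group G] (m : ℕ) (T A : G) (W : Fin m → Fin m → G)
    (hT : T * T = 1) (hs : ∀ x y, W x y = W y x)
    (h2 : ∀ x y, x ≠ y → W x y * W x y = 1)
    (hc : ∀ x y z t, x ≠ y → z ≠ t → W x y * W z t = W (swap x y z) (swap x y t) * W x y)
    (hTW : ∀ x y, x ≠ y → T * W x y = W x y * T)
    (hTA : T * A * T = A⁻¹)
    (hWA : ∀ (i : ℕ) (h : i + 1 < m), 1 ≤ i →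
      W ⟨i, by omega⟩ ⟨i + 1, h⟩ * A = A * W ⟨i, by omega⟩ ⟨i + 1, h⟩)
    (hk : ∀ (h : 0 + 1 < m) (k : ℤ),
      ⁅T * W ⟨0, by omega⟩ ⟨0 + 1, h⟩,
        (A ^ k)⁻¹ * (T * W ⟨0, by omega⟩ ⟨0 + 1, h⟩) * A ^ k⁆ = 1) :
    ∃ F : YT m →* G, F (τ m) = T ∧ F (a m) = A ∧
      ∀ i h, F (sTilde m i h) = W ⟨i, by omega⟩ ⟨i + 1, h⟩ := by
  obtain ⟨f, hf⟩ := exists_permHom m (fun x y => if x = y then 1 else T * W x y)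
    (fun x => by simp) (fun x y => by simp only [eq_comm (a := x), hs x y])
    (fun x y => by
      split_ifs with h
      · simp
      · rw [mul_assoc, ← mul_assoc (W x y), ← hTW x y h, mul_assoc T, h2 x y h, mul_one, hT])
    (fun x y z t => by
      by_cases hxy : x = y
      · simp [hxy]
      by_cases hzt : z = t
      · simp [hzt]
      have h' : swap x y z ≠ swap x y t := fun h => hzt ((swap x y).injective h)
      simp only [hxy, hzt, h', if_false]
      rw [mul_assoc, ← mul_assoc (W x y), ← hTW x y hxy, mul_assoc T (W x y), hc x y z t hxy hzt,
        mul_assoc T (W (swap x y z) _), ← mul_assoc (W (swap x y z) _), ← hTW _ _ h', mul_assoc T])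
  have hf' : ∀ i h, f (adj m i h) = T * W ⟨i, by omega⟩ ⟨i + 1, h⟩ := fun i h => by
    rw [adj, hf, if_neg (by simp)]
  obtain ⟨g, ga, gp⟩ := Y.exists_lift m A f (fun h k => by rw [hf']; exact hk h k)
    (fun i h hi => by
      have hTi : T⁻¹ = T := inv_eq_of_mul_eq_one_left hT
      have h := hWA i h hi
      rw [hf', mul_inv_rev, hTi]
      generalize W _ _ = w at h ⊢
      calc w⁻¹ * T * A * (T * w) * A = w⁻¹ * (T * A * T) * (w * A) := by group
        _ = 1 := by rw [hTA, h]; group)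
  have hz : ∀ x : Multiplicative (ZMod 2), x = 1 ∨ x = Multiplicative.ofAdd 1 := by decide
  have hne : (Multiplicative.ofAdd 1 : Multiplicative (ZMod 2)) ≠ 1 := by decide
  have hsq : (Multiplicative.ofAdd 1 : Multiplicative (ZMod 2)) * Multiplicative.ofAdd 1 = 1 := by
    decide
  let t : Multiplicative (ZMod 2) →* G := MonoidHom.mk' (fun x => if x = 1 then 1 else T) (by
    intro x y
    rcases hz x with rfl | rfl
    · simp
    · rcases hz y with rfl | rfl
      · simp
      · rw [hsq, if_pos rfl, if_neg hne, hT])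
  have ht : t (Multiplicative.ofAdd 1) = T := by
    simp [t, hne]
  refine ⟨SemidirectProduct.lift g t fun x => ?_, ?_, ?_, fun i h => ?_⟩
  · rcases hz x with rfl | rfl
    · refine MonoidHom.ext fun y => ?_
      simp
    · rw [Y.tauAct_gen, ht]
      refine Y.hom_ext ?_ fun σ => ?_
      · change g (Y.tauHom m (Y.a m)) = T * g (Y.a m) * T⁻¹
        rw [Y.tauHom_a, map_inv, ga, ← hTA, inv_eq_of_mul_eq_one_left hT]
      · change g (Y.tauHom m (Y.perm m σ)) = T * g (Y.perm m σ) * T⁻¹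
        rw [Y.tauHom_perm, gp, eq_mul_inv_iff_mul_eq]
        induction σ using Equiv.Perm.swap_induction_on with
        | one => simp
        | swap_mul σ x y hxy ih =>
          rw [map_mul, mul_assoc, ih, ← mul_assoc, ← mul_assoc, hf, if_neg hxy,
            mul_assoc T, ← hTW x y hxy, mul_assoc T, mul_assoc T]
  · rw [τ, SemidirectProduct.lift_inr, ht]
  · rw [a, SemidirectProduct.lift_inl, ga]
  · rw [sTilde, map_mul, τ, s, SemidirectProduct.lift_inr, SemidirectProduct.lift_inl, ht, Y.s, gp,
      hf', ← mul_assoc, hT, one_mul]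
theorem hom_ext {G : Type*} [Group G] {m : ℕ} {F F' : YT m →* G} (hτ : F (τ m) = F' (τ m))
    (ha : F (a m) = F' (a m)) (hs : ∀ i h, F (sTilde m i h) = F' (sTilde m i h)) : F = F' := by
  refine SemidirectProduct.hom_ext (Y.hom_ext ha fun σ => ?_) (MonoidHom.ext fun x => ?_)
  · cases m with
    | zero => rw [Subsingleton.elim σ 1, map_one, map_one, map_one]
    | succ n =>
      have h : ∀ i h, F (s (n + 1) i h) = F' (s (n + 1) i h) := fun i h => by
        have := hs i h
        rwa [sTilde, map_mul, map_mul, hτ, mul_right_inj] at this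
      have e := MonoidHom.eq_of_eqOn_denseM (Equiv.Perm.mclosure_swap_castSucc_succ n)
        (f := (F.comp SemidirectProduct.inl).comp (Y.perm (n + 1)))
        (g := (F'.comp SemidirectProduct.inl).comp (Y.perm (n + 1))) (by
          rintro _ ⟨i, rfl⟩
          exact h i.1 (by omega))
      exact DFunLike.congr_fun e σ
  · have hz : ∀ x : Multiplicative (ZMod 2), x = 1 ∨ x = Multiplicative.ofAdd 1 := by decide
    rcases hz x with rfl | rfl
    · rw [map_one, map_one]
    · exact hτ

end YT

/-! ### The two representations -/

theorem pow_form (m : ℕ) : ∃ α β : ℕ → R, ∀ c : (Cl m)ˣ,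
    (c : Cl m) + ((c⁻¹ : (Cl m)ˣ) : Cl m) = (LaurentPolynomial.T 1 : R) • (1 : Cl m) →
    ∀ k, ((c ^ k : (Cl m)ˣ) : Cl m) = α k • (1 : Cl m) + β k • (c : Cl m) := by
  let p : ℕ → R × R := fun k =>
    Nat.rec (1, 0) (fun _ x => (x.2, x.1 + LaurentPolynomial.T 1 * x.2)) k
  refine ⟨fun k => (p k).1, fun k => (p k).2, fun c hc k => ?_⟩
  have hsq : (c : Cl m) * c = (LaurentPolynomial.T 1 : R) • (c : Cl m) + 1 := by
    have h := congrArg (fun x => x * (c : Cl m)) hc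
    simp only [add_mul, Units.inv_mul, smul_mul_assoc, one_mul] at h
    rw [← h, add_assoc, add_self_Cl, add_zero]
  induction k with
  | zero => simp [p]
  | succ k ih =>
    change _ = (p (k + 1)).1 • (1 : Cl m) + (p (k + 1)).2 • (c : Cl m)
    change _ = (p k).1 • (1 : Cl m) + (p k).2 • (c : Cl m) at ih
    have e1 : (p (k + 1)).1 = (p k).2 := rfl
    have e2 : (p (k + 1)).2 = (p k).1 + LaurentPolynomial.T 1 * (p k).2 := rfl
    rw [pow_succ, Units.val_mul, ih, e1, e2, add_mul, smul_mul_assoc, smul_mul_assoc, hsq, one_mul]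
    module

theorem pow_comm_nat {m : ℕ} (X Y : (Cl m)ˣ)
    (hX : (X : Cl m) + ((X⁻¹ : (Cl m)ˣ) : Cl m) = (LaurentPolynomial.T 1 : R) • (1 : Cl m))
    (hY : (Y : Cl m) + ((Y⁻¹ : (Cl m)ˣ) : Cl m) = (LaurentPolynomial.T 1 : R) • (1 : Cl m))
    (hXY : (X : Cl m) * Y + Y * X = ((LaurentPolynomial.T 1 : R) * LaurentPolynomial.T 1) • (1 : Cl m) +
      (LaurentPolynomial.T 1 : R) • ((X : Cl m) + Y)) (k : ℕ) :
    Y ^ k * X ^ k = X⁻¹ ^ k * Y⁻¹ ^ k := by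
  obtain ⟨α, β, h⟩ := pow_form m
  have hX' : ((X⁻¹ : (Cl m)ˣ) : Cl m) = (LaurentPolynomial.T 1 : R) • (1 : Cl m) + X := by
    rw [← hX, add_right_comm, add_self_Cl, zero_add]
  have hY' : ((Y⁻¹ : (Cl m)ˣ) : Cl m) = (LaurentPolynomial.T 1 : R) • (1 : Cl m) + Y := by
    rw [← hY, add_right_comm, add_self_Cl, zero_add]
  ext1
  rw [Units.val_mul, Units.val_mul, h Y hY, h X hX, h X⁻¹ (by rw [inv_inv, add_comm, hX]),
    h Y⁻¹ (by rw [inv_inv, add_comm, hY]), hX', hY']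
  simp only [mul_add, add_mul, smul_mul_assoc, mul_smul_comm, one_mul, mul_one, smul_add]
  have h2 : ∀ x : Cl m, (2 : R) • x = 0 := fun x => by rw [two_R, zero_smul]
  generalize (LaurentPolynomial.T 1 : R) = σ at *
  generalize α k = p
  generalize β k = r
  linear_combination (norm := module) (r * r) • hXY - h2 ((r * r) • ((X : Cl m) * Y)) -
    h2 ((p * r * σ) • (1 : Cl m))


theorem pow_comm {m : ℕ} (X Y : (Cl m)ˣ)
    (hX : (X : Cl m) + ((X⁻¹ : (Cl m)ˣ) : Cl m) = (LaurentPolynomial.T 1 : R) • (1 : Cl m))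
    (hY : (Y : Cl m) + ((Y⁻¹ : (Cl m)ˣ) : Cl m) = (LaurentPolynomial.T 1 : R) • (1 : Cl m))
    (hXY : (X : Cl m) * Y + Y * X =
      ((LaurentPolynomial.T 1 : R) * LaurentPolynomial.T 1) • (1 : Cl m) +
      (LaurentPolynomial.T 1 : R) • ((X : Cl m) + Y)) (k : ℤ) :
    Y ^ k * X ^ k = X⁻¹ ^ k * Y⁻¹ ^ k := by
  obtain ⟨n, rfl | rfl⟩ := k.eq_nat_or_neg
  · exact_mod_cast pow_comm_nat X Y hX hY hXY n
  · have h1 := pow_comm_nat X Y hX hY hXY n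
    -- `Y ^ n * X ^ n` is an involution, hence so is its conjugate `X ^ n * Y ^ n`
    simp only [zpow_neg, zpow_natCast, inv_pow, inv_inv] at *
    have h3 : X ^ n * (Y ^ n * X ^ n) * Y ^ n = 1 := by rw [h1]; group
    have h4 : (X ^ n * Y ^ n) * (X ^ n * Y ^ n) = 1 := by rw [← h3]; group
    rw [← mul_inv_rev]
    exact inv_eq_of_mul_eq_one_left h4

theorem v_mul_v (m : ℕ) (x y : Fin m) (h : x ≠ y) :
    ι m (v m x) * ι m (v m y) = 1 + ι m (v m y) * ι m (v m x) := by
  have := CliffordAlgebra.ι_mul_ι_add_swap (Q := q m) (v m x) (v m y)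
  rw [polar_v_v m x y h, map_one] at this
  rw [← this, add_assoc, add_self_Cl, add_zero]

theorem v_mul_u (m : ℕ) (x : Fin m) :
    ι m (v m x) * ι m (u m) = 1 + ι m (u m) * ι m (v m x) := by
  have := CliffordAlgebra.ι_mul_ι_add_swap (Q := q m) (u m) (v m x)
  rw [polar_u_v m x, map_one] at this
  rw [← this, add_right_comm, add_self_Cl, zero_add]

theorem w_mul_v (m : ℕ) (x y z : Fin m) (h : x ≠ y) :
    ι m (v m x + v m y) * ι m (v m z) = ι m (v m (swap x y z)) * ι m (v m x + v m y) := by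
  have hq : ∀ i j, ι m (v m i) * ι m (v m i) = ι m (v m j) * ι m (v m j) := fun i j => by
    rw [CliffordAlgebra.ι_sq_scalar, CliffordAlgebra.ι_sq_scalar, q_v, q_v]
  by_cases hx : z = x
  · subst hx
    rw [swap_apply_left, map_add, add_mul, mul_add, hq z y, add_comm]
  by_cases hy : z = y
  · subst hy
    rw [swap_apply_right, map_add, add_mul, mul_add, hq z x, add_comm]
  rw [swap_apply_of_ne_of_ne hx hy, map_add, add_mul, mul_add, v_mul_v m x z (Ne.symm hx),
    v_mul_v m y z (Ne.symm hy), add_add_add_comm, add_self_Cl, zero_add]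

theorem w_mul_u (m : ℕ) (x y : Fin m) :
    ι m (v m x + v m y) * ι m (u m) = ι m (u m) * ι m (v m x + v m y) := by
  rw [map_add, add_mul, mul_add, v_mul_u, v_mul_u, add_add_add_comm, add_self_Cl, zero_add]

theorem q_s_v (m : ℕ) (i : Fin m) :
    q m ((LaurentPolynomial.T 1 : R) • v m i) = 1 := by
  rw [QuadraticMap.map_smul, q_v, smul_eq_mul, ← LaurentPolynomial.T_add,
    ← LaurentPolynomial.T_add, ← LaurentPolynomial.T_zero]
  rfl

open Classical in
/-- The element `v x + v y` of the pin group, for `x ≠ y`. -/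
noncomputable def pinW (m : ℕ) (x y : Fin m) : Pin m :=
  if h : x = y then 1 else pinVec m (v m x + v m y) (q_v_add_v m x y h)

theorem coe_pinW (m : ℕ) (x y : Fin m) (h : x ≠ y) :
    ((pinW m x y).1.1 : Cl m) = ι m (v m x + v m y) := by
  rw [pinW, dif_neg h]; rfl

noncomputable def pinU (m : ℕ) : Pin m := pinVec m (u m) (q_u m)

/-- The element `s v_i` of the pin group. -/
noncomputable def pinSV (m : ℕ) (i : Fin m) : Pin m :=
  pinVec m ((LaurentPolynomial.T 1 : R) • v m i) (q_s_v m i)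

theorem pinVec_sq (m : ℕ) (w : V m) (hw : q m w = 1) : pinVec m w hw * pinVec m w hw = 1 :=
  Pin_ext (ι_sq m w hw)

theorem pinW_mul_pinSV (m : ℕ) (x y z : Fin m) (h : x ≠ y) :
    pinW m x y * pinSV m z = pinSV m (swap x y z) * pinW m x y := by
  apply Pin_ext
  change ((pinW m x y).1.1 : Cl m) * ι m ((LaurentPolynomial.T 1 : R) • v m z) =
    ι m ((LaurentPolynomial.T 1 : R) • v m (swap x y z)) * ((pinW m x y).1.1 : Cl m)
  rw [coe_pinW m x y h, map_smul, map_smul, mul_smul_comm, smul_mul_assoc, w_mul_v m x y z h]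

theorem pinU_mul_pinW (m : ℕ) (x y : Fin m) (h : x ≠ y) :
    pinU m * pinW m x y = pinW m x y * pinU m := by
  apply Pin_ext
  change ι m (u m) * ((pinW m x y).1.1 : Cl m) = ((pinW m x y).1.1 : Cl m) * ι m (u m)
  rw [coe_pinW m x y h, w_mul_u]

theorem pinW_mul_pinW (m : ℕ) (x y z t : Fin m) (h : x ≠ y) (h' : z ≠ t) :
    pinW m x y * pinW m z t = pinW m (swap x y z) (swap x y t) * pinW m x y := by
  apply Pin_ext
  change ((pinW m x y).1.1 : Cl m) * ((pinW m z t).1.1 : Cl m) =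
    ((pinW m (swap x y z) (swap x y t)).1.1 : Cl m) * ((pinW m x y).1.1 : Cl m)
  rw [coe_pinW m x y h, coe_pinW m z t h',
    coe_pinW m _ _ (fun e => h' ((swap x y).injective e)), map_add (ι m) (v m z),
    map_add (ι m) (v m (swap x y z)), mul_add, add_mul, w_mul_v m x y z h, w_mul_v m x y t h]

theorem pinW_symm (m : ℕ) (x y : Fin m) : pinW m x y = pinW m y x := by
  by_cases h : x = y
  · rw [h]
  · apply Pin_ext
    rw [coe_pinW m x y h, coe_pinW m y x (Ne.symm h), add_comm (v m x)]

theorem pinW_sq (m : ℕ) (x y : Fin m) (h : x ≠ y) : pinW m x y * pinW m x y = 1 := by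
  rw [pinW, dif_neg h, pinVec_sq]

theorem pin_pow_comm (m : ℕ) (x y : Fin m) (h : x ≠ y) (k : ℤ) :
    (pinU m * pinSV m y) ^ k * (pinU m * pinSV m x) ^ k =
      (pinU m * pinSV m x)⁻¹ ^ k * (pinU m * pinSV m y)⁻¹ ^ k := by
  have hval : ∀ i : Fin m, ((pinU m * pinSV m i).1.1 : Cl m) =
      (LaurentPolynomial.T 1 : R) • (ι m (u m) * ι m (v m i)) := fun i => by
    change ι m (u m) * ι m ((LaurentPolynomial.T 1 : R) • v m i) = _
    rw [map_smul, mul_smul_comm]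
  have hinv : ∀ i : Fin m, ((((pinU m * pinSV m i).1.1)⁻¹ : (Cl m)ˣ) : Cl m) =
      (LaurentPolynomial.T 1 : R) • (ι m (v m i) * ι m (u m)) := fun i => by
    change ι m ((LaurentPolynomial.T 1 : R) • v m i) * ι m (u m) = _
    rw [map_smul, smul_mul_assoc]
  have hadd : ∀ i : Fin m, ((pinU m * pinSV m i).1.1 : Cl m) +
      ((((pinU m * pinSV m i).1.1)⁻¹ : (Cl m)ˣ) : Cl m) =
      (LaurentPolynomial.T 1 : R) • (1 : Cl m) := fun i => by
    rw [hval, hinv, v_mul_u, ← smul_add, add_left_comm, add_self_Cl, add_zero]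
  have huv : ∀ i j : Fin m, ι m (u m) * ι m (v m i) * (ι m (u m) * ι m (v m j)) =
      ι m (u m) * ι m (v m j) + ι m (v m i) * ι m (v m j) := fun i j => by
    rw [mul_assoc, ← mul_assoc (ι m (v m i)), v_mul_u, add_mul, one_mul, mul_add, mul_assoc,
      ← mul_assoc (ι m (u m)) (ι m (u m)), ι_sq m _ (q_u m), one_mul]
  have := pow_comm (pinU m * pinSV m x).1.1 (pinU m * pinSV m y).1.1 (hadd x) (hadd y) (by
    rw [hval, hval]
    simp only [smul_mul_assoc, mul_smul_comm, huv, v_mul_v m x y h]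
    have h2 : ∀ x : Cl m, (2 : R) • x = 0 := fun x => by rw [two_R, zero_smul]
    linear_combination (norm := module) h2 (((LaurentPolynomial.T 1 : R) * LaurentPolynomial.T 1) •
      (ι m (v m y) * ι m (v m x)))) k
  exact Subtype.ext (Subtype.ext this)

theorem comm_aux {G : Type*} [Group G] (T W X X' : G) (hU : T * T = 1) (hW : W * W = 1)
    (hX1 : X' * X' = 1) (hTW : T * W = W * T) (hWX : W * X = X' * W) (k : ℤ)
    (hE : (T * X') ^ k * (T * X) ^ k = (T * X)⁻¹ ^ k * (T * X')⁻¹ ^ k) :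
    ⁅T * W, ((T * X) ^ k)⁻¹ * (T * W) * (T * X) ^ k⁆ = 1 := by
  have hTi : T⁻¹ = T := inv_eq_of_mul_eq_one_left hU
  have hX'i : X'⁻¹ = X' := inv_eq_of_mul_eq_one_left hX1
  have hx2 : (T * W) * (T * W) = 1 := by
    rw [mul_assoc, ← mul_assoc W, ← hTW, mul_assoc T W, hW, mul_one, hU]
  have hxi : (T * W)⁻¹ = T * W := inv_eq_of_mul_eq_one_left hx2
  have hconj : (T * W) * (T * X) * (T * W)⁻¹ = (T * X')⁻¹ := by
    rw [hxi, mul_inv_rev, hTi, hX'i]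
    calc T * W * (T * X) * (T * W) = T * (W * T) * X * (T * W) := by group
      _ = T * T * (W * X) * (T * W) := by rw [← hTW]; group
      _ = X' * W * (W * T) := by rw [hU, one_mul, hWX, hTW]
      _ = X' * (W * W) * T := by group
      _ = X' * T := by rw [hW, mul_one]
  have hconjk : ∀ n : ℤ, (T * W) * (T * X) ^ n * (T * W)⁻¹ = (T * X')⁻¹ ^ n := fun n => by
    rw [← hconj, conj_zpow]
  rw [commutatorElement_eq_one_iff_mul_comm]
  have l1 : (T * W) * (((T * X) ^ k)⁻¹ * (T * W) * (T * X) ^ k) =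
      (T * X') ^ k * (T * X) ^ k := by
    calc _ = (T * W) * (T * X) ^ (-k) * (T * W)⁻¹ * (T * X) ^ k := by
          rw [hxi, zpow_neg]; simp only [mul_assoc]
      _ = _ := by rw [hconjk, inv_zpow, zpow_neg, inv_inv]
  have l2 : ((T * X) ^ k)⁻¹ * (T * W) * (T * X) ^ k * (T * W) =
      (T * X)⁻¹ ^ k * (T * X')⁻¹ ^ k := by
    calc _ = ((T * X) ^ k)⁻¹ * ((T * W) * (T * X) ^ k * (T * W)⁻¹) := by
          rw [hxi]; simp only [mul_assoc]
      _ = _ := by rw [hconjk, inv_zpow (T * X)]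
  rw [l1, l2, hE]

theorem exists_psi (m : ℕ) [NeZero m] : ∃ F : YT m →* Pin m,
    F (YT.τ m) = pinU m ∧ F (YT.a m) = pinU m * pinSV m 0 ∧
      ∀ i h, F (YT.sTilde m i h) = pinW m ⟨i, by omega⟩ ⟨i + 1, h⟩ := by
  have hU : pinU m * pinU m = 1 := pinVec_sq m _ _
  have hX : ∀ i, pinSV m i * pinSV m i = 1 := fun i => pinVec_sq m _ _
  refine YT.exists_lift m (pinU m) (pinU m * pinSV m 0) (pinW m) hU (pinW_symm m) (pinW_sq m)
    (pinW_mul_pinW m) (pinU_mul_pinW m) ?_ ?_ ?_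
  · rw [← mul_assoc, hU, one_mul]
    exact eq_inv_of_mul_eq_one_left (by
      rw [mul_assoc, ← mul_assoc (pinU m), hU, one_mul, hX])
  · intro i h hi
    have hne : (⟨i, by omega⟩ : Fin m) ≠ ⟨i + 1, h⟩ := by simp
    rw [← mul_assoc, ← pinU_mul_pinW m _ _ hne, mul_assoc, pinW_mul_pinSV m _ _ _ hne,
      swap_apply_of_ne_of_ne, mul_assoc]
    · intro e
      have := congrArg Fin.val e
      simp at this
      omega
    · intro e
      have := congrArg Fin.val e
      simp at this
  · intro h k
    have e0 : (⟨0, by omega⟩ : Fin m) = 0 := rfl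
    have hne : (0 : Fin m) ≠ ⟨0 + 1, h⟩ := fun e => by
      have := congrArg Fin.val e
      simp at this
    rw [e0]
    have hW := pinW_sq m _ _ hne
    have hTW := pinU_mul_pinW m _ _ hne
    have hWX := pinW_mul_pinSV m 0 _ 0 hne
    rw [swap_apply_left] at hWX
    have hE := pin_pow_comm m 0 _ hne k
    exact comm_aux _ _ _ _ hU hW (hX _) hTW hWX k hE

/-- The homomorphism `ψ : ỹ(m) → Pin(V, q)` with `τ ↦ u`, `a ↦ s u v₁` and `s̃_i ↦ v_i + v_{i+1}`;
see `ψ_τ`, `ψ_a` and `ψ_sTilde`. -/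
noncomputable def ψ (m : ℕ) [NeZero m] : YT m →* Pin m := (exists_psi m).choose

theorem ψ_τ (m : ℕ) [NeZero m] : ((ψ m (YT.τ m)).1.1 : Cl m) = ι m (u m) := by
  rw [ψ, (exists_psi m).choose_spec.1]; rfl

theorem ψ_a (m : ℕ) [NeZero m] : ((ψ m (YT.a m)).1.1 : Cl m) =
    (LaurentPolynomial.T 1 : R) • (ι m (u m) * ι m (v m 0)) := by
  rw [ψ, (exists_psi m).choose_spec.2.1]
  change ι m (u m) * ι m ((LaurentPolynomial.T 1 : R) • v m 0) = _
  rw [map_smul, mul_smul_comm]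

theorem ψ_sTilde (m : ℕ) [NeZero m] (i : ℕ) (h : i + 1 < m) :
    ((ψ m (YT.sTilde m i h)).1.1 : Cl m) = ι m (v m ⟨i, by omega⟩ + v m ⟨i + 1, h⟩) := by
  rw [ψ, (exists_psi m).choose_spec.2.2 i h, coe_pinW m _ _ (by simp)]

theorem isUnit_q_u (m : ℕ) : IsUnit (q m (u m)) := by rw [q_u]; exact isUnit_one

theorem isUnit_q_v (m : ℕ) (i : Fin m) : IsUnit (q m (v m i)) := by
  rw [q_v]; exact LaurentPolynomial.isUnit_T _

theorem isUnit_q_w (m : ℕ) (i j : Fin m) (h : i ≠ j) : IsUnit (q m (v m i + v m j)) := by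
  rw [q_v_add_v m i j h]; exact isUnit_one

theorem exists_phi (m : ℕ) [NeZero m] : ∃ F : YT m →* (SO m)ᵐᵒᵖ,
    F (YT.τ m) = MulOpposite.op (transv m (u m) (isUnit_q_u m)) ∧
    F (YT.a m) = MulOpposite.op (transv m (u m) (isUnit_q_u m)) *
      MulOpposite.op (transv m (v m 0) (isUnit_q_v m 0)) ∧
    ∀ (i : ℕ) (h : i + 1 < m), F (YT.sTilde m i h) =
      MulOpposite.op (transv m (v m ⟨i, by omega⟩ + v m ⟨i + 1, h⟩)
        (isUnit_q_w m _ _ (by simp))) := by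
  obtain ⟨F, h1, h2, h3⟩ := exists_psi m
  refine ⟨(π m).comp ((Pin m).subtype.comp F), ?_, ?_, fun i h => ?_⟩
  · rw [MonoidHom.comp_apply, MonoidHom.comp_apply, h1]
    exact π_pinVec m _ (q_u m) _ 1 (one_smul _ _).symm _
  · rw [MonoidHom.comp_apply, MonoidHom.comp_apply, h2, map_mul, map_mul]
    exact congrArg₂ _ (π_pinVec m _ (q_u m) _ 1 (one_smul _ _).symm _)
      (π_pinVec m _ (q_s_v m 0) _ _ rfl _)
  · rw [MonoidHom.comp_apply, MonoidHom.comp_apply, h3, pinW, dif_neg (by simp)]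
    exact π_pinVec m _ (q_v_add_v m _ _ (by simp)) _ 1 (one_smul _ _).symm _

/-- The homomorphism `φ : ỹ(m) → SO(V, q)` with `τ ↦ r_u`, `a ↦ r_u r_{v₁}` and
`s̃_i ↦ r_{v_i + v_{i+1}}`; see `φ_τ`, `φ_a` and `φ_sTilde`. As in `π`, the orthogonal group acts
from the right. -/
noncomputable def φ (m : ℕ) [NeZero m] : YT m →* (SO m)ᵐᵒᵖ := (exists_phi m).choose

theorem φ_τ (m : ℕ) [NeZero m] :
    φ m (YT.τ m) = MulOpposite.op (transv m (u m) (isUnit_q_u m)) :=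
  (exists_phi m).choose_spec.1

theorem φ_a (m : ℕ) [NeZero m] :
    φ m (YT.a m) = MulOpposite.op (transv m (u m) (isUnit_q_u m)) *
      MulOpposite.op (transv m (v m 0) (isUnit_q_v m 0)) :=
  (exists_phi m).choose_spec.2.1

theorem φ_sTilde (m : ℕ) [NeZero m] (i : ℕ) (h : i + 1 < m) :
    φ m (YT.sTilde m i h) = MulOpposite.op (transv m (v m ⟨i, by omega⟩ + v m ⟨i + 1, h⟩)
      (isUnit_q_w m _ _ (by simp))) :=
  (exists_phi m).choose_spec.2.2 i h

end YGroup

/-! Everything reduces to showing that `c = ψ g` with `π c = 1` is trivial.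

Since `α` is the identity in characteristic two, `π c = 1` says that `c` commutes with every vector.
Over `R` the centraliser of `V` is found by contractions: `w * x + x * w` is the contraction of `x`
with `(w, ·)` (`commutator_ι_eq_contractLeft`), and `changeForm` carries contractions to the
exterior algebra. An element killed by all `(u + v i, ·)` comes from their common kernel, the line
spanned by `radVec`. Hence `c = α + β • radVec` (`exists_eq_add_smul_radVec`). If `c` is even, the
second term vanishes, and the pin condition gives `α * α = 1`, so `α = 1` (`eq_one_of_mem_even`).

Some restriction to the image of `ψ` is needed: if `4` divides `m`, then `radVec` is central with
`q` equal to `1`, so it is an odd element of `Pin` killed by `π`. Nor can parity be read off from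
`α`, which is trivial.

Parity comes from the specialisation `s = 1`. There `V` becomes the module of even-weight vectors in
`𝔽₂^(m+2)` with the dot product, and the vectors `u`, `s v₁`, `v_i + v_{i+1}` that build the image
of `ψ` become sums of two unit vectors, whose transvections are transpositions. Thus each element of
the image acts as a permutation whose sign is its Clifford parity (`ψ_mem_permSubgroup`). If `π c =
1`, this permutation is trivial, so `c` is even (`mem_even_of_mem_permSubgroup`). -/

namespace YGroup

open Equiv

/-! ### Elements killed by contractions -/

section Exterior

variable {K M : Type*} [CommRing K] [AddCommGroup M] [Module K M]

/-- Decomposition of an element of the exterior algebra along a vector and a linear form. -/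
theorem exteriorAlgebra_map_add_mul_contractLeft (d : Module.Dual K M) (e : M)
    (x : ExteriorAlgebra K M) :
    ExteriorAlgebra.map (LinearMap.id - d.smulRight e) x +
      ExteriorAlgebra.ι K e * CliffordAlgebra.contractLeft (Q := 0) d x = x := by
  induction x using CliffordAlgebra.left_induction with
  | algebraMap r =>
    rw [CliffordAlgebra.contractLeft_algebraMap, mul_zero, add_zero]
    exact AlgHom.commutes _ r
  | add x y hx hy =>
    rw [map_add, map_add, mul_add, add_add_add_comm, hx, hy]
  | ι_mul y a hy =>
    have hmap : ExteriorAlgebra.map (LinearMap.id - d.smulRight e)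
        (CliffordAlgebra.ι (0 : QuadraticForm K M) a) =
        ExteriorAlgebra.ι K a - d a • ExteriorAlgebra.ι K e := by
      refine (ExteriorAlgebra.map_apply_ι _ a).trans ?_
      simp
    have he : ExteriorAlgebra.ι K e * ExteriorAlgebra.ι K e = 0 :=
      ExteriorAlgebra.ι_sq_zero e
    have hae : ExteriorAlgebra.ι K e * ExteriorAlgebra.ι K a =
        -(ExteriorAlgebra.ι K a * ExteriorAlgebra.ι K e) :=
      eq_neg_of_add_eq_zero_left (ExteriorAlgebra.ι_add_mul_swap e a)
    rw [CliffordAlgebra.contractLeft_ι_mul, map_mul, hmap]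
    change _ + _ * (_ - ExteriorAlgebra.ι K a * _) = ExteriorAlgebra.ι K a * _
    set D : ExteriorAlgebra K M := CliffordAlgebra.contractLeft (Q := 0) d y
    -- The induction hypothesis eliminates the image of `y`. What remains is an identity in `y` and
    -- `D`, in which the term quadratic in `e` dies because `e` squares to zero, and the others
    -- cancel by anticommutation.
    have h1 : ExteriorAlgebra.map (LinearMap.id - d.smulRight e) y =
        y - ExteriorAlgebra.ι K e * D := eq_sub_of_add_eq hy
    have h2 : ExteriorAlgebra.ι K e * (ExteriorAlgebra.ι K a * D) =
        -(ExteriorAlgebra.ι K a * (ExteriorAlgebra.ι K e * D)) := by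
      rw [← mul_assoc, hae, neg_mul, mul_assoc]
    have h3 : ExteriorAlgebra.ι K e * (ExteriorAlgebra.ι K e * D) = 0 := by
      rw [← mul_assoc, he, zero_mul]
    rw [h1, mul_sub, mul_sub, sub_mul, sub_mul, smul_mul_assoc, smul_mul_assoc, mul_smul_comm,
      h2, h3, smul_zero]
    abel

theorem exteriorAlgebra_map_eq_self {d : Module.Dual K M} (e : M) {x : ExteriorAlgebra K M}
    (hx : CliffordAlgebra.contractLeft (Q := 0) d x = 0) :
    ExteriorAlgebra.map (LinearMap.id - d.smulRight e) x = x := by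
  have := exteriorAlgebra_map_add_mul_contractLeft d e x
  rwa [hx, mul_zero, add_zero] at this

/-- An element of the exterior algebra killed by the contractions with a finite family of linear
forms that has a dual family comes from the common kernel of these forms. -/
theorem exists_exteriorAlgebra_map_eq_self {n : Type*} [DecidableEq n] (d : n → Module.Dual K M)
    (e : n → M) (hde : ∀ i j, d i (e j) = if i = j then 1 else 0) {x : ExteriorAlgebra K M}
    (hx : ∀ i, CliffordAlgebra.contractLeft (Q := 0) (d i) x = 0) (S : Finset n) :
    ∃ f : M →ₗ[K] M, ExteriorAlgebra.map f x = x ∧ ∀ i ∈ S, ∀ a, d i (f a) = 0 := by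
  induction S using Finset.induction_on with
  | empty => exact ⟨LinearMap.id, by rw [ExteriorAlgebra.map_id]; rfl, by simp⟩
  | insert j S hj ih =>
    obtain ⟨f, hf, hS⟩ := ih
    -- Follow `f` by the projection along `e j` onto the kernel of `d j`. As `d i (e j) = 0` for `i
    -- ≠ j`, this does not disturb the forms already killed.
    refine ⟨(LinearMap.id - (d j).smulRight (e j)) ∘ₗ f, ?_, fun i hi a => ?_⟩
    · rw [← ExteriorAlgebra.map_comp_map, AlgHom.comp_apply, hf,
        exteriorAlgebra_map_eq_self (e j) (hx j)]
    · have h : d i (((LinearMap.id - (d j).smulRight (e j)) ∘ₗ f) a) =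
          d i (f a) - d j (f a) * d i (e j) := by simp
      rw [h, hde]
      by_cases hij : i = j
      · simp [hij]
      · rw [hS i (Finset.mem_of_mem_insert_of_ne hi hij), if_neg hij, mul_zero, sub_zero]

/-- The combinations of `1` and `z` are closed under products because `z` squares to zero, so they
contain the subalgebra generated by the image of `f`. -/
theorem exteriorAlgebra_map_mem_of_range_le_span (f : M →ₗ[K] M) (z : M)
    (hf : ∀ a, ∃ r : K, f a = r • z) (x : ExteriorAlgebra K M) :
    ∃ α β : K, ExteriorAlgebra.map f x = algebraMap K _ α + β • ExteriorAlgebra.ι K z := by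
  induction x using ExteriorAlgebra.induction with
  | algebraMap r => exact ⟨r, 0, by simp⟩
  | ι a =>
    obtain ⟨r, hr⟩ := hf a
    exact ⟨0, r, by simp [hr]⟩
  | mul x y hx hy =>
    obtain ⟨α, β, hx⟩ := hx
    obtain ⟨γ, δ, hy⟩ := hy
    refine ⟨α * γ, α * δ + γ * β, ?_⟩
    simp only [map_mul, hx, hy, mul_add, add_mul, smul_mul_assoc, mul_smul_comm,
      ExteriorAlgebra.ι_sq_zero, smul_zero, add_zero, Algebra.algebraMap_eq_smul_one, one_mul,
      mul_one]
    module
  | add x y hx hy =>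
    obtain ⟨α, β, hx⟩ := hx
    obtain ⟨γ, δ, hy⟩ := hy
    refine ⟨α + γ, β + δ, ?_⟩
    rw [map_add, hx, hy, map_add, add_smul, add_add_add_comm]

end Exterior

/-! ### Central elements of the Clifford algebra -/

/-- Contraction with `(w, ·)` is the twisted commutator with `w`, and signs disappear in
characteristic two. This turns commuting with `w` into a condition that survives the passage to the
exterior algebra. -/
theorem commutator_ι_eq_contractLeft (m : ℕ) (w : V m) (x : Cl m) :
    CliffordAlgebra.contractLeft ((q m).polarBilin w) x = ι m w * x + x * ι m w := by
  induction x using CliffordAlgebra.left_induction with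
  | algebraMap r =>
    rw [CliffordAlgebra.contractLeft_algebraMap, Algebra.commutes, add_self_Cl]
  | add x y hx hy =>
    rw [map_add, hx, hy, mul_add, add_mul, add_add_add_comm]
  | ι_mul y a hy =>
    rw [CliffordAlgebra.contractLeft_ι_mul, hy, Algebra.smul_def,
      QuadraticMap.polarBilin_apply_apply, ← CliffordAlgebra.ι_mul_ι_add_swap, sub_eq_add_neg,
      neg_eq_Cl, add_mul, mul_add, mul_assoc, mul_assoc, add_assoc,
      ← add_assoc (ι m a * (ι m w * y)) (ι m a * (ι m w * y)), add_self_Cl, zero_add, mul_assoc]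

/-- The coordinates of `u + v i` sum to zero, so the product of sums in `polar_eq` drops out. The
resulting forms have the `v i` as a dual family over `R`, so nothing has to be inverted. -/
theorem polarBilin_u_add_v (m : ℕ) (i : Fin m) (x : V m) :
    (q m).polarBilin (u m + v m i) x = x 0 + x i.succ := by
  rw [QuadraticMap.polarBilin_apply_apply, polar_eq]
  simp [u, v, Finset.sum_add_distrib, add_mul, add_self_R, Pi.single_apply]

/-- An element of the Clifford algebra commuting with all vectors is a combination of `1` and the
sum of the basis vectors. -/
theorem exists_eq_add_smul_radVec {m : ℕ} {c : Cl m} (hc : ∀ w, ι m w * c = c * ι m w) :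
    ∃ α β : R, c = algebraMap R _ α + β • ι m (radVec m) := by
  -- The triangular, non-symmetric `qBilin` has `q` on its diagonal, which identifies the Clifford
  -- algebra with the exterior algebra as a module without dividing by two.
  have h : (qBilin m).toQuadraticMap = q m - 0 := by rw [sub_zero, q]
  let h' := CliffordAlgebra.changeForm.neg_proof h
  let d : Fin m → Module.Dual R (V m) := fun i => (q m).polarBilin (u m + v m i)
  have hd : ∀ i x, d i x = x 0 + x i.succ := polarBilin_u_add_v m
  have hx : ∀ i, CliffordAlgebra.contractLeft (d i) (CliffordAlgebra.changeForm h' c) = 0 :=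
    fun i => by
      rw [← CliffordAlgebra.changeForm_contractLeft, commutator_ι_eq_contractLeft, hc,
        add_self_Cl, map_zero]
  obtain ⟨f, hf, hf0⟩ := exists_exteriorAlgebra_map_eq_self d (v m)
    (fun i j => by simp [hd, v, Pi.single_apply]) hx Finset.univ
  -- In the common kernel every coordinate equals the zeroth one.
  have hspan : ∀ a, ∃ r : R, f a = r • radVec m := fun a => by
    refine ⟨f a 0, funext fun i => ?_⟩
    refine Fin.cases ?_ (fun i => ?_) i
    · simp [radVec]
    · have := hf0 i (Finset.mem_univ i) a
      rw [hd] at this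
      simpa [radVec, neg_eq_R] using (neg_eq_of_add_eq_zero_right this).symm
  obtain ⟨α, β, hαβ⟩ := exteriorAlgebra_map_mem_of_range_le_span f (radVec m) hspan
    (CliffordAlgebra.changeForm h' c)
  refine ⟨α, β, (CliffordAlgebra.changeFormEquiv h').injective ?_⟩
  change CliffordAlgebra.changeForm h' c = CliffordAlgebra.changeForm h' _
  rw [← hf, hαβ, map_add, map_smul, CliffordAlgebra.changeForm_algebraMap,
    CliffordAlgebra.changeForm_ι]

/-- Evenness removes the `radVec` term from a central element, and the pin condition then determines
the remaining scalar. -/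
theorem eq_one_of_mem_even {m : ℕ} {c : Pin m} (hπ : π m c.1 = 1)
    (he : (c.1.1 : Cl m) ∈ CliffordAlgebra.evenOdd (q m) 0) : c = 1 := by
  have hc : ∀ w, ι m w * (c.1.1 : Cl m) = (c.1.1 : Cl m) * ι m w := fun w => by
    have := ι_π c.1 w
    rw [hπ] at this
    change ι m w = _ at this
    rw [mul_assoc] at this
    exact (Units.eq_inv_mul_iff_mul_eq _).1 this |>.symm
  obtain ⟨α, β, h⟩ := exists_eq_add_smul_radVec hc
  have hα : algebraMap R (Cl m) α ∈ CliffordAlgebra.evenOdd (q m) 0 :=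
    SetLike.algebraMap_mem_graded (CliffordAlgebra.evenOdd (q m)) α
  -- This term is odd, and it is also even as the difference of `c` and a scalar.
  have hβ : β • ι m (radVec m) = 0 := by
    refine (Submodule.disjoint_def.1 (CliffordAlgebra.evenOdd_isCompl (Q := q m)).disjoint) _ ?_
      (Submodule.smul_mem _ _ (CliffordAlgebra.ι_mem_evenOdd_one _ _))
    rw [eq_sub_of_add_eq' h.symm]
    exact Submodule.sub_mem _ he hα
  rw [hβ, add_zero] at h
  have hpin : (c.1.1 : Cl m) * conj (c.1.1 : Cl m) = 1 := c.2
  rw [h, conj, involute_eq, CliffordAlgebra.reverse.commutes, ← map_mul] at hpin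
  have hsq : α * α = 1 := algebraMap_injective m (hpin.trans (map_one _).symm)
  -- In characteristic two `α * α = 1` is a vanishing square, and `R` has no nilpotents.
  have h0 : (α + 1) ^ 2 = 0 := by linear_combination hsq + (α + 1) * two_R
  have h1 : α = 1 := by
    have := pow_eq_zero_iff (two_ne_zero) |>.1 h0
    linear_combination this - two_R
  apply Pin_ext
  rw [h, h1, map_one]
  rfl

/-! ### Reduction to the symmetric group on `m + 2` letters at `s = 1` -/

/-- The specialisation `s = 1`. -/
noncomputable def evalOne : R →+* ZMod 2 :=
  LaurentPolynomial.eval₂ (RingHom.id (ZMod 2)) 1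

theorem evalOne_T (n : ℤ) : evalOne (LaurentPolynomial.T n) = 1 := by
  simp [evalOne]

/-- The additive map sending the `i`-th basis vector to `e₀ + e_{i+1}`, over `s ↦ 1`. -/
noncomputable def toPerm (m : ℕ) (x : V m) : Fin (m + 2) → ZMod 2 :=
  Fin.cons (∑ i, evalOne (x i)) fun i => evalOne (x i)

theorem toPerm_add (m : ℕ) (x y : V m) : toPerm m (x + y) = toPerm m x + toPerm m y := by
  funext k
  refine Fin.cases ?_ (fun k => ?_) k <;> simp [toPerm, Finset.sum_add_distrib]

theorem toPerm_smul (m : ℕ) (r : R) (x : V m) :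
    toPerm m (r • x) = evalOne r • toPerm m x := by
  funext k
  refine Fin.cases ?_ (fun k => ?_) k <;> simp [toPerm, Finset.mul_sum]

theorem toPerm_single (m : ℕ) (i : Fin (m + 1)) :
    toPerm m (Pi.single i 1) = Pi.single 0 1 + Pi.single i.succ 1 := by
  funext k
  refine Fin.cases ?_ (fun k => ?_) k
  · simp [toPerm, Pi.single_apply, apply_ite evalOne, (Fin.succ_ne_zero i).symm]
  · simp [toPerm, Pi.single_apply, apply_ite evalOne]

/-- The extra zeroth coordinate of `toPerm`, the sum of the others, supplies exactly the product of
sums in `polar_eq`. -/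
theorem evalOne_polar (m : ℕ) (x y : V m) :
    evalOne (QuadraticMap.polar (q m) x y) = ∑ k, toPerm m x k * toPerm m y k := by
  rw [polar_eq, Fin.sum_univ_succ (n := m + 1)]
  simp only [toPerm, Fin.cons_zero, Fin.cons_succ, map_add, map_mul, map_sum]

/-- The transvection along `e_a + e_b` adds `x a + x b` to the coordinates `a` and `b`, which over
`𝔽₂` exchanges them. -/
theorem add_sum_smul_eq_comp_swap {n : Type*} [Fintype n] [DecidableEq n] (x : n → ZMod 2)
    {a b : n} (hab : a ≠ b) :
    x + (∑ k, (Pi.single a 1 + Pi.single b 1 : n → ZMod 2) k * x k) •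
      (Pi.single a 1 + Pi.single b 1 : n → ZMod 2) = x ∘ swap a b := by
  have h2 : ∀ z : ZMod 2, z + z = 0 := CharTwo.add_self_eq_zero
  have hs : ∑ k, (Pi.single a 1 + Pi.single b 1 : n → ZMod 2) k * x k = x a + x b := by
    simp [add_mul, Finset.sum_add_distrib, Pi.single_apply]
  rw [hs]
  funext k
  by_cases ha : k = a
  · subst ha
    simp [hab, ← add_assoc, h2]
  by_cases hb : k = b
  · subst hb
    simp only [Pi.add_apply, Pi.smul_apply, Pi.single_apply, ha, if_false, if_true, zero_add,
      smul_eq_mul, mul_one, Function.comp_apply, swap_apply_right]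
    rw [add_left_comm, h2, add_zero]
  · simp [ha, hb, swap_apply_of_ne_of_ne ha hb]

/-- `c` acts at `s = 1` as a permutation whose sign is the degree of `c`. -/
def ActsAs {m : ℕ} (c : Pin m) (σ : Perm (Fin (m + 2))) (n : ZMod 2) : Prop :=
  (c.1.1 : Cl m) ∈ CliffordAlgebra.evenOdd (q m) n ∧
    (Perm.sign σ = if n = 0 then 1 else -1) ∧
    ∀ x, toPerm m ((π m c.1).unop.1 x) = toPerm m x ∘ σ

/-- The elements of the pin group that act at `s = 1` as permutations of matching sign. -/
def permSubgroup (m : ℕ) : Subgroup (Pin m) where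
  carrier := {c | ∃ σ n, ActsAs c σ n}
  one_mem' := ⟨1, 0, SetLike.one_mem_graded _, by simp, fun x => by
    rw [OneMemClass.coe_one, map_one]; rfl⟩
  mul_mem' := by
    rintro c d ⟨σ, n, h1, h2, h3⟩ ⟨τ, k, k1, k2, k3⟩
    -- Precomposition is a right action, so the order of the product agrees with that in `(SO
    -- m)ᵐᵒᵖ`.
    refine ⟨σ * τ, n + k, SetLike.mul_mem_graded h1 k1, ?_, fun x => ?_⟩
    · rw [map_mul, h2, k2]
      clear h1 h2 h3 k1 k2 k3
      revert n k
      decide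
    · rw [Subgroup.coe_mul, map_mul]
      refine (k3 _).trans ?_
      exact congrArg (· ∘ τ) (h3 x)
  inv_mem' := by
    rintro c ⟨σ, n, h1, h2, h3⟩
    refine ⟨σ⁻¹, n, ?_, by rw [Perm.sign_inv, h2], fun x => ?_⟩
    -- By the pin condition the inverse is the reversal, which preserves parity.
    · have h : ((c⁻¹).1.1 : Cl m) = CliffordAlgebra.reverse (c.1.1 : Cl m) := by
        rw [← involute_eq (CliffordAlgebra.reverse _)]
        exact Units.inv_eq_of_mul_eq_one_right c.2
      rw [h]
      exact (CliffordAlgebra.reverse_mem_evenOdd_iff (q m)).2 h1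
    · have h := h3 ((π m (c⁻¹).1).unop.1 x)
      have e : (π m c.1).unop.1 ((π m (c⁻¹).1).unop.1 x) = x := by
        have : π m (c⁻¹).1 * π m c.1 = 1 := by
          rw [← map_mul, ← Subgroup.coe_mul, inv_mul_cancel, OneMemClass.coe_one, map_one]
        exact congrArg (fun g : (SO m)ᵐᵒᵖ => g.unop.1 x) this
      rw [e] at h
      rw [h]
      funext k
      simp

/-- A vector has odd degree and acts as its transvection, which at `s = 1` is a transposition, of
sign `-1`. -/
theorem pinVec_mem_permSubgroup (m : ℕ) (w : V m) (hw : q m w = 1) {a b : Fin (m + 2)}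
    (hab : a ≠ b) (h : toPerm m w = Pi.single a 1 + Pi.single b 1) :
    pinVec m w hw ∈ permSubgroup m := by
  refine ⟨swap a b, 1, CliffordAlgebra.ι_mem_evenOdd_one _ _, by simp [Perm.sign_swap hab],
    fun x => ?_⟩
  have hu : IsUnit (q m w) := by rw [hw]; exact isUnit_one
  have h1 : (↑hu.unit⁻¹ : R) = 1 := by
    have : (↑hu.unit⁻¹ : R) * q m w = 1 := hu.val_inv_mul
    exact (mul_one _).symm.trans ((congrArg _ hw.symm).trans this)
  rw [π_pinVec m w hw w 1 (one_smul _ _).symm hu, MulOpposite.unop_op, transv_apply, h1, one_mul,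
    toPerm_add, toPerm_smul, QuadraticMap.polar_comm, evalOne_polar, h,
    add_sum_smul_eq_comp_swap _ hab]

/-- The symmetric group acts faithfully on even-weight vectors as soon as there are three letters,
so the permutation is trivial and its sign forces even degree. -/
theorem mem_even_of_mem_permSubgroup {m : ℕ} [NeZero m] {c : Pin m} (hc : c ∈ permSubgroup m)
    (hπ : π m c.1 = 1) : (c.1.1 : Cl m) ∈ CliffordAlgebra.evenOdd (q m) 0 := by
  obtain ⟨σ, n, h1, h2, h3⟩ := hc
  -- The image of the `i`-th basis vector is the indicator of `{0, i + 1}`, so fixing it means that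
  -- `σ` preserves this pair.
  have hx : ∀ (i : Fin (m + 1)) k, σ k = 0 ∨ σ k = i.succ ↔ k = 0 ∨ k = i.succ := by
    intro i k
    have h := congrFun (h3 (Pi.single i 1)) k
    rw [hπ] at h
    change toPerm m (Pi.single i 1) k = _ at h
    rw [Function.comp_apply, toPerm_single] at h
    have key : ∀ l : Fin (m + 2), (Pi.single 0 1 + Pi.single i.succ 1 : Fin (m + 2) → ZMod 2) l =
        if l = 0 ∨ l = i.succ then 1 else 0 := by
      intro l
      by_cases h0 : l = 0
      · subst h0
        simp [(Fin.succ_ne_zero i).symm]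
      · simp [Pi.single_apply, h0]
    rw [key, key] at h
    by_cases hk : k = 0 ∨ k = i.succ <;> by_cases hl : σ k = 0 ∨ σ k = i.succ <;>
      simp [hk, hl] at h ⊢
  -- Here `m ≥ 1` is essential: two distinct pairs `{0, 1}` and `{0, m + 1}` meet only in `0`, which
  -- is therefore fixed. On two letters the swap would preserve the only pair.
  have hne : (0 : Fin (m + 1)) ≠ Fin.last m := by
    intro h
    have := congrArg Fin.val h
    simp at this
    exact NeZero.ne m this.symm
  have h0 : σ 0 = 0 := by
    rcases (hx 0 0).2 (Or.inl rfl) with h | h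
    · exact h
    · rcases (hx (Fin.last m) 0).2 (Or.inl rfl) with h' | h'
      · exact h'
      · exact absurd (Fin.succ_injective _ (h.symm.trans h')) hne
  have hσ : σ = 1 := by
    ext k
    refine congrArg Fin.val ?_
    refine Fin.cases h0 (fun i => ?_) k
    rcases (hx i i.succ).2 (Or.inr rfl) with h | h
    · exact absurd (σ.injective (h.trans h0.symm)) (Fin.succ_ne_zero i)
    · exact h
  have hn : n = 0 := by
    by_contra hn
    rw [hσ, map_one, if_neg hn] at h2
    exact absurd h2 (by decide)
  rwa [hn] at h1

/-! ### Generation of `ỹ(m)` -/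

theorem Y.eq_top_of_mem {m : ℕ} (H : Subgroup (Y m)) (ha : Y.a m ∈ H)
    (hs : ∀ i h, Y.s m i h ∈ H) : H = ⊤ := by
  have hp : ∀ σ, Y.perm m σ ∈ H := by
    cases m with
    | zero => intro σ; rw [Subsingleton.elim σ 1, map_one]; exact one_mem H
    | succ n =>
      have hle : Submonoid.closure
          (Set.range fun i : Fin n => swap i.castSucc i.succ) ≤
          (H.comap (Y.perm (n + 1))).toSubmonoid := by
        rw [Submonoid.closure_le]
        rintro _ ⟨i, rfl⟩
        exact hs i.1 (by omega)
      rw [Equiv.Perm.mclosure_swap_castSucc_succ] at hle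
      exact fun σ => hle (Submonoid.mem_top σ)
  refine (Subgroup.eq_top_iff' H).2 fun y => ?_
  obtain ⟨x, rfl⟩ := QuotientGroup.mk_surjective y
  induction x using Monoid.Coprod.induction_on with
  | inl z =>
    have : (QuotientGroup.mk (Monoid.Coprod.inl z) : Y m) = Y.a m ^ z.toAdd := by
      rw [Y.a, preA, ← QuotientGroup.mk_zpow, ← map_zpow, ← ofAdd_zsmul, smul_eq_mul, mul_one,
        ofAdd_toAdd]
    rw [this]
    exact zpow_mem ha _
  | inr σ => exact hp σ
  | mul x y hx hy => rw [QuotientGroup.mk_mul]; exact mul_mem hx hy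

theorem YT.eq_top_of_mem {m : ℕ} (H : Subgroup (YT m)) (hτ : YT.τ m ∈ H) (ha : YT.a m ∈ H)
    (hs : ∀ i h, YT.sTilde m i h ∈ H) : H = ⊤ := by
  have hY : H.comap SemidirectProduct.inl = ⊤ := by
    refine Y.eq_top_of_mem _ ha fun i h => ?_
    have := mul_mem (inv_mem hτ) (hs i h)
    rwa [YT.sTilde, inv_mul_cancel_left] at this
  refine (Subgroup.eq_top_iff' H).2 fun g => ?_
  rw [← SemidirectProduct.inl_left_mul_inr_right g]
  refine mul_mem ((Subgroup.eq_top_iff' _).1 hY g.left) ?_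
  have hz : ∀ x : Multiplicative (ZMod 2), x = 1 ∨ x = Multiplicative.ofAdd 1 := by decide
  rcases hz g.right with h | h <;> rw [h]
  · rw [map_one]; exact one_mem H
  · exact hτ

/-- It suffices to check generators. On the letters `0, …, m + 1`, the vector `u` gives `(0 1)`, `s
v₁` gives `(0 2)`, and `v x + v y` gives the transposition of `x + 2` and `y + 2`. -/
theorem ψ_mem_permSubgroup (m : ℕ) [NeZero m] (g : YT m) : ψ m g ∈ permSubgroup m := by
  have hv : ∀ i, toPerm m (v m i) = Pi.single 0 1 + Pi.single i.succ.succ 1 := fun i =>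
    toPerm_single m i.succ
  have hU : pinU m ∈ permSubgroup m :=
    pinVec_mem_permSubgroup m _ _ (Fin.succ_ne_zero 0).symm (toPerm_single m 0)
  have hS : pinSV m 0 ∈ permSubgroup m :=
    pinVec_mem_permSubgroup m _ _ (Fin.succ_ne_zero (Fin.succ 0)).symm
      (by rw [toPerm_smul, evalOne_T, one_smul, hv])
  have hW : ∀ x y, x ≠ y → pinW m x y ∈ permSubgroup m := fun x y hxy => by
    rw [pinW, dif_neg hxy]
    refine pinVec_mem_permSubgroup m _ _ (a := x.succ.succ) (b := y.succ.succ) ?_ ?_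
    · exact fun h => hxy (Fin.succ_injective _ (Fin.succ_injective _ h))
    -- The two copies of `e₀` cancel.
    · rw [toPerm_add, hv, hv]
      funext k
      simp only [Pi.add_apply]
      rw [add_add_add_comm, CharTwo.add_self_eq_zero, zero_add]
  have := YT.eq_top_of_mem ((permSubgroup m).comap (ψ m)) ?_ ?_ fun i h => ?_
  · exact (Subgroup.eq_top_iff' _).1 this g
  · rw [Subgroup.mem_comap, ψ, (exists_psi m).choose_spec.1]
    exact hU
  · rw [Subgroup.mem_comap, ψ, (exists_psi m).choose_spec.2.1]
    exact mul_mem hU hS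
  · rw [Subgroup.mem_comap, ψ, (exists_psi m).choose_spec.2.2]
    exact hW _ _ (by simp)

/-! ### Factorisation of `φ` and injectivity of `π` on the image of `ψ` -/

theorem ψ_eq_one_of_π_eq_one {m : ℕ} [NeZero m] {g : YT m} (h : π m (ψ m g).1 = 1) :
    ψ m g = 1 :=
  eq_one_of_mem_even h (mem_even_of_mem_permSubgroup (ψ_mem_permSubgroup m g) h)

/-- Both sides agree on generators. The factor `s` in the image of `a` makes `s v₁` a vector with
`q` equal to `1`, and it is invisible to `π` because proportional vectors have the same
transvection. -/
theorem φ_eq_π_comp_ψ (m : ℕ) [NeZero m] : φ m = (π m).comp ((Pin m).subtype.comp (ψ m)) := by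
  refine YT.hom_ext ?_ ?_ fun i h => ?_
  · rw [φ_τ, MonoidHom.comp_apply, MonoidHom.comp_apply, ψ, (exists_psi m).choose_spec.1]
    exact (π_pinVec m _ (q_u m) _ 1 (one_smul _ _).symm _).symm
  · rw [φ_a, MonoidHom.comp_apply, MonoidHom.comp_apply, ψ, (exists_psi m).choose_spec.2.1,
      map_mul, map_mul]
    exact (congrArg₂ _ (π_pinVec m _ (q_u m) _ 1 (one_smul _ _).symm _)
      (π_pinVec m _ (q_s_v m 0) _ _ rfl _)).symm
  · rw [φ_sTilde, MonoidHom.comp_apply, MonoidHom.comp_apply, ψ, (exists_psi m).choose_spec.2.2,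
      pinW, dif_neg (by simp)]
    exact (π_pinVec m _ (q_v_add_v m _ _ (by simp)) _ 1 (one_smul _ _).symm _).symm

theorem injOn_π_range_ψ (m : ℕ) [NeZero m] :
    Set.InjOn (π m) (Set.range fun g : YT m => (ψ m g : CliffordGroup m)) := by
  rintro _ ⟨g, rfl⟩ _ ⟨h, rfl⟩ hgh
  have h1 : π m (ψ m (g * h⁻¹)).1 = 1 := by
    rw [map_mul, map_inv, Subgroup.coe_mul, Subgroup.coe_inv, map_mul, map_inv]
    exact mul_inv_eq_one.2 hgh
  have h2 := ψ_eq_one_of_π_eq_one h1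
  rw [map_mul, map_inv, mul_inv_eq_one] at h2
  exact congrArg Subtype.val h2

end YGroup

theorem mainTheorem4 (m : ℕ) [NeZero m] :
    YGroup.φ m = (YGroup.π m).comp ((YGroup.Pin m).subtype.comp (YGroup.ψ m)) ∧
    Set.InjOn (YGroup.π m)
      (Set.range fun g : YGroup.YT m => (YGroup.ψ m g : YGroup.CliffordGroup m)) ∧
    (∃ e : (YGroup.ψ m).range ≃* (YGroup.φ m).range, ∀ c : (YGroup.ψ m).range,
      ((e c : (YGroup.φ m).range) : (YGroup.SO m)ᵐᵒᵖ) =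
        YGroup.π m ((c : YGroup.Pin m) : YGroup.CliffordGroup m)) ∧
    (YGroup.φ m).ker = (YGroup.ψ m).ker := by
  have hφ := YGroup.φ_eq_π_comp_ψ m
  have hinj := YGroup.injOn_π_range_ψ m
  have hφ' : ∀ g, YGroup.φ m g = YGroup.π m (YGroup.ψ m g).1 := fun g => DFunLike.congr_fun hφ g
  refine ⟨hφ, hinj, ?_, ?_⟩
  -- The isomorphism is `π` itself, corestricted: injectivity is `hinj`, and surjectivity is the
  -- factorisation of `φ`.
  · let f : (YGroup.ψ m).range →* (YGroup.φ m).range :=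
      (((YGroup.π m).comp (YGroup.Pin m).subtype).comp (YGroup.ψ m).range.subtype).codRestrict _ (by
        rintro ⟨_, g, rfl⟩
        exact ⟨g, hφ' g⟩)
    refine ⟨MulEquiv.ofBijective f ⟨?_, ?_⟩, fun c => rfl⟩
    · rintro ⟨_, g, rfl⟩ ⟨_, h, rfl⟩ hgh
      exact Subtype.ext (Subtype.ext (hinj ⟨g, rfl⟩ ⟨h, rfl⟩ (congrArg Subtype.val hgh)))
    · rintro ⟨_, g, rfl⟩
      exact ⟨⟨_, g, rfl⟩, Subtype.ext (hφ' g).symm⟩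
  · ext g
    rw [MonoidHom.mem_ker, MonoidHom.mem_ker, hφ']
    refine ⟨YGroup.ψ_eq_one_of_π_eq_one, fun h => ?_⟩
    rw [h, OneMemClass.coe_one, map_one]
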